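/- **Theorem.** Assume $\mathsf{W[1]}\neq\mathsf{FPT}$, in the following form: there are no computable function $f:\mathbb N\to\mathbb N$ and constant $c$ such that $k$-Clique (given an undirected graph $G$ and a number $k$, decide whether $G$ has a clique of size $k$) is solved by an algorithm in time $f(k)\cdot(\text{input size}+1)^{c}$. Here an algorithm is a deterministic multi-stack Turing machine, one machine for all $k$, and time is its number of steps. In $k$-VectorSum over $\mathbb F_2$ one is given $k$ finite sets of vectors $V_1,\dots,V_k\subseteq\mathbb F_2^{d}$ and a target vector $\vec t\in\mathbb F_2^{d}$, and has to decide whether there are $\vec v_1\in V_1,\dots,\vec v_k\in V_k$ with $\sum_{i=1}^k\vec v_i=\vec t$. The parameter is $k$; write $n=\sum_{i=1}^k|V_i|$ for the number of vectors in the input. Then $k$-VectorSum over $\mathbb F_2$ with $d=\Theta(k\log n)$ cannot be solved in $f(k)\cdot\mathrm{poly}(n)$ time. Precisely, there are constants $c_1,c_2>0$ such that for no computable function $f:\mathbb N\to\mathbb N$ and no constant $c$ is there an algorithm that, on every instance with $c_1\,k\log n\le d\le c_2\,k\log n$, gives the correct answer in time $f(k)\cdot(\text{input size}+1)^{c}$.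 (Nothing is required of the algorithm on other inputs.) -/

import Mathlib

/-- A parameterized decision problem: instances, their parameter, their encoding as words over the
finite alphabet `{0, 1, #}` (bits `some b` and the separator `none`), and the set of
yes-instances. -/
structure ParamProblem where
  Inst : Type
  param : Inst → ℕ
  encode : Inst → List (Option Bool)
  encode_injective : Function.Injective encode
  Yes : Inst → Prop

namespace ParamProblem

/-- The problem `P` on the instances that satisfy `S` only: nothing is asked of an algorithm on any
other input. -/
def restrict (P : ParamProblem) (S : P.Inst → Prop) : ParamProblem where
  Inst := { x : P.Inst // S x }
  param x := P.param x
  encode x := P.encode x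
  encode_injective := P.encode_injective.comp Subtype.val_injective
  Yes x := P.Yes x

open Classical in
/-- Some deterministic multi-stack Turing machine, started on the encoding of any instance `x`,
halts with the correct answer bit after at most `T x` steps. -/
def SolvableInTime (P : ParamProblem) (T : P.Inst → ℕ) : Prop :=
  ∃ M : Turing.TM2ComputableAux (Option Bool) Bool, ∀ x : P.Inst,
    Nonempty (Turing.TM2OutputsInTime M.tm ((P.encode x).map M.inputAlphabet.symm)
      (some ([decide (P.Yes x)].map M.outputAlphabet.symm)) (T x))

/-- Solvable in time `f(k) · poly(input size)` for a computable function `f` of the parameter `k`,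
by one algorithm for all `k`. -/
def FPT (P : ParamProblem) : Prop :=
  ∃ f : ℕ → ℕ, Computable f ∧ ∃ c : ℕ,
    P.SolvableInTime fun x => f (P.param x) * ((P.encode x).length + 1) ^ c

end ParamProblem

/-- The number `m` in unary, followed by the separator. -/
def encodeUnary (m : ℕ) : List (Option Bool) :=
  List.replicate m (some true) ++ [none]

theorem encodeUnary_append_inj {a b : ℕ} {l r : List (Option Bool)}
    (h : encodeUnary a ++ l = encodeUnary b ++ r) : a = b ∧ l = r := by
  induction a generalizing b with
  | zero => cases b <;> simp_all [encodeUnary, List.replicate_succ]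
  | succ a ih =>
    cases b with
    | zero => simp_all [encodeUnary, List.replicate_succ]
    | succ b =>
      have : encodeUnary a ++ l = encodeUnary b ++ r := by
        simpa [encodeUnary, List.replicate_succ] using h
      simpa using ih this

/-- An input of the clique problem: a graph on `n` vertices and the number `k`. -/
structure CliqueInstance where
  n : ℕ
  k : ℕ
  G : SimpleGraph (Fin n)

open Classical in
/-- `k` and `n` in unary, then the adjacency matrix row by row. -/
noncomputable def CliqueInstance.encode (x : CliqueInstance) : List (Option Bool) :=
  encodeUnary x.k ++ (encodeUnary x.n ++
    (List.ofFn fun u : Fin x.n => List.ofFn fun v : Fin x.n => some (decide (x.G.Adj u v))).flatten)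

theorem CliqueInstance.encode_injective : Function.Injective CliqueInstance.encode := by
  rintro ⟨n, k, G⟩ ⟨n', k', G'⟩ h
  obtain ⟨hk, h⟩ := encodeUnary_append_inj h
  obtain ⟨hn, h⟩ := encodeUnary_append_inj h
  dsimp only at hk hn h
  subst hk hn
  have h2 := List.eq_iff_flatten_eq.2 ⟨h, by simp [List.map_ofFn, Function.comp_def]⟩
  have h3 := List.ofFn_injective h2
  congr 1
  ext u v
  have h4 := congrFun (List.ofFn_injective (congrFun h3 u)) v
  simpa using h4

/-- `k`-Clique: is there a clique of size `k`? -/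
noncomputable def kClique : ParamProblem where
  Inst := CliqueInstance
  param x := x.k
  encode := CliqueInstance.encode
  encode_injective := CliqueInstance.encode_injective
  Yes x := ∃ s : Finset (Fin x.n), x.G.IsNClique x.k s

/-- The hypothesis W[1] ≠ FPT, in the form of the intractability of the W[1]-complete problem
`k`-Clique. -/
def W1NeFPT : Prop := ¬ kClique.FPT

/-- An input of the vector sum problem over `𝔽₂`: `k` sets of vectors of dimension `d`, each listed
without repetition in some order, and a target vector. -/
structure VectorSumInstance where
  k : ℕ
  d : ℕ
  V : Fin k → List (Fin d → ZMod 2)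
  nodup : ∀ i, (V i).Nodup
  t : Fin d → ZMod 2

/-- The bits of a vector over `𝔽₂`. -/
def encodeVec {d : ℕ} (v : Fin d → ZMod 2) : List (Option Bool) :=
  List.ofFn fun j => some (decide (v j = 1))

/-- A list of vectors: each vector is announced by a `1`, and the list is closed by the
separator. -/
def encodeGroup {d : ℕ} (L : List (Fin d → ZMod 2)) : List (Option Bool) :=
  L.flatMap (fun v => some true :: encodeVec v) ++ [none]

theorem encodeVec_injective {d : ℕ} :
    Function.Injective (encodeVec : (Fin d → ZMod 2) → List (Option Bool)) := by
  intro v w h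
  have h2 := List.ofFn_injective h
  funext j
  have h3 := congrFun h2 j
  have key : ∀ a b : ZMod 2, (a = 1 ↔ b = 1) → a = b := by decide
  exact key _ _ (by simpa using h3)

theorem encodeGroup_append_inj {d : ℕ} {L L' : List (Fin d → ZMod 2)} {r r' : List (Option Bool)}
    (h : encodeGroup L ++ r = encodeGroup L' ++ r') : L = L' ∧ r = r' := by
  induction L generalizing L' with
  | nil => cases L' <;> simp_all [encodeGroup]
  | cons v L ih =>
    cases L' with
    | nil => simp_all [encodeGroup]
    | cons w L' =>
      have h1 : encodeVec v ++ (encodeGroup L ++ r) = encodeVec w ++ (encodeGroup L' ++ r') := by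
        simpa [encodeGroup] using h
      obtain ⟨h2, h3⟩ := List.append_inj h1 (by simp [encodeVec])
      obtain ⟨h4, h5⟩ := ih h3
      exact ⟨by rw [encodeVec_injective h2, h4], h5⟩

/-- `k` and `d` in unary, then the `k` groups one after the other, then the target vector. -/
def VectorSumInstance.encode (x : VectorSumInstance) : List (Option Bool) :=
  encodeUnary x.k ++ (encodeUnary x.d ++
    ((List.ofFn fun i => encodeGroup (x.V i)).flatten ++ encodeVec x.t))

theorem VectorSumInstance.encode_injective : Function.Injective VectorSumInstance.encode := by
  rintro ⟨k, d, V, hV, t⟩ ⟨k', d', V', hV', t'⟩ h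
  obtain ⟨hk, h⟩ := encodeUnary_append_inj h
  obtain ⟨hd, h⟩ := encodeUnary_append_inj h
  dsimp only at hk hd h
  subst hk hd
  have key : V = V' ∧ encodeVec t = encodeVec t' := by
    clear * - h
    generalize encodeVec t = r at h ⊢
    generalize encodeVec t' = r' at h ⊢
    induction k with
    | zero => exact ⟨Subsingleton.elim _ _, by simpa using h⟩
    | succ k ih =>
      have h1 : encodeGroup (V 0) ++
            ((List.ofFn fun i : Fin k => encodeGroup (V i.succ)).flatten ++ r) =
          encodeGroup (V' 0) ++
            ((List.ofFn fun i : Fin k => encodeGroup (V' i.succ)).flatten ++ r') := by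
        simpa [List.ofFn_succ] using h
      obtain ⟨h2, h3⟩ := encodeGroup_append_inj h1
      obtain ⟨h4, h5⟩ := ih (fun i => V i.succ) (fun i => V' i.succ) h3
      refine ⟨funext fun i => ?_, h5⟩
      cases i using Fin.cases with
      | zero => exact h2
      | succ i => exact congrFun h4 i
  obtain ⟨h1, h2⟩ := key
  subst h1
  rw [encodeVec_injective h2]

/-- The total number `n` of vectors in the input. -/
def VectorSumInstance.n (x : VectorSumInstance) : ℕ := ∑ i, (x.V i).length

/-- `k`-VectorSum over `𝔽₂`: can one pick one vector from each of the `k` sets so that the picked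
vectors sum up to the target? -/
def kVectorSum : ParamProblem where
  Inst := VectorSumInstance
  param x := x.k
  encode := VectorSumInstance.encode
  encode_injective := VectorSumInstance.encode_injective
  Yes x := ∃ v : Fin x.k → (Fin x.d → ZMod 2), (∀ i, v i ∈ x.V i) ∧ ∑ i, v i = x.t

/-! Clique is reduced to VectorSum with target zero and K = 2k² sets. For every ordered pair (i, j)
of clique positions there is a set in two copies. A vector of an off-diagonal set stands for an
ordered pair (u, v) of adjacent vertices, and a vector of a diagonal set (i, i) for a pair (u, u),
that is, for a choice of the i-th clique vertex. The coordinates form k × k blocks of four quarters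
of L bits, and a quarter holds a vertex identifier or zeros.

In the first quarter of block (a, b) with a ≠ b, exactly the first copies of (a, b) and (a, a)
contribute, each with its first vertex. Over 𝔽₂ the quarter vanishes iff these vertices agree. The
second quarter compares the second vertices of (a, b) and (b, b) in the same way. Hence the sum is
zero only if the edge picked for (a, b) joins the vertices picked at (a, a) and (b, b). Vertices
picked at different positions are then adjacent, hence distinct, and form a k-clique. The last two
quarters hold the pair itself in both copies. They vanish iff the copies agree, and they keep the
vectors of one set distinct even where the first two quarters are zero. This is
`sum_pairVec_eq_zero_iff`, `pairVec_injOn` and `sumInstance_yes_iff`.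

Let N be the number of vertices and L the binary length of kN. Then d = 4k²L = 2KL. The diagonal
sets alone give n ≥ 2kN, and n ≤ 2(kN)² always, so log n lies between L log 2 and 3L log 2. This
places d in the window required by `sumInstance_dim`. Taking the length of kN rather than of N is
what makes this hold also when k is large compared with N.

The reduction must be carried out by the machine model itself. It is written as a structured routine
on stacks of symbols, with explicit stores and step bounds (`reduction_runs`), and `precompose` puts
it in front of a solver for VectorSum. The new parameter 2k² depends on k only and the step bound is
polynomial, so a fast solver would put Clique in FPT. -/

namespace StackMachine

/-! ### Stack routines and their step semantics -/

/-- The tape symbols: bits and the separator. -/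
abbrev Sym := Option Bool

/-- The contents of all stacks. -/
abbrev Store (K : Type) := K → List Sym

/-- An elementary action: push a symbol, or pop one and branch on it. A missing target label means
leaving the routine. -/
inductive Action (K Λ : Type)
  | push (k : K) (a : Sym) (next : Option Λ)
  | pop (k : K) (next : Option Sym → Option Λ)

namespace Action

variable {K Λ Λ' : Type}

def map (g : Option Λ → Option Λ') : Action K Λ → Action K Λ'
  | push k a n => push k a (g n)
  | pop k n => pop k (fun o => g (n o))

/-- A pop branches on the symbol it removes, so the store here is the one before the action. An
empty stack shows as `none`. -/
def target (s : Store K) : Action K Λ → Option Λ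
  | push _ _ n => n
  | pop k n => n (s k).head?

def exec [DecidableEq K] (s : Store K) : Action K Λ → Store K
  | push k a _ => Function.update s k (a :: s k)
  | pop k _ => Function.update s k (s k).tail

theorem target_map (g : Option Λ → Option Λ') (s : Store K) (A : Action K Λ) :
    (A.map g).target s = g (A.target s) := by
  cases A <;> rfl

theorem exec_map [DecidableEq K] (g : Option Λ → Option Λ') (s : Store K) (A : Action K Λ) :
    (A.map g).exec s = A.exec s := by
  cases A <;> rfl

end Action

/-- A routine with one entry and one exit. -/
structure Routine (K : Type) where
  Label : Type
  [fin : Fintype Label]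
  entry : Option Label
  act : Label → Action K Label

attribute [instance] Routine.fin

namespace Routine

variable {K : Type} [DecidableEq K]

/-- Control passes from `l` with store `s` to `l'` with store `s'` in at most `n` steps. -/
inductive Reach (R : Routine K) (l' : Option R.Label) (s' : Store K) :
    ℕ → Option R.Label → Store K → Prop
  | refl (n : ℕ) : Reach R l' s' n l' s'
  | step {n : ℕ} {l : R.Label} {s : Store K}
      (h : Reach R l' s' n ((R.act l).target s) ((R.act l).exec s)) : Reach R l' s' (n + 1) (some l) s

/-- The routine turns the store `s` into `s'` within `t` steps. -/
def Runs (R : Routine K) (t : ℕ) (s s' : Store K) : Prop := R.Reach none s' t R.entry s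

theorem Reach.mono {R : Routine K} {l l' : Option R.Label} {s s' : Store K} {m n : ℕ}
    (h : R.Reach l' s' m l s) (hmn : m ≤ n) : R.Reach l' s' n l s := by
  induction h generalizing n with
  | refl => exact .refl n
  | step _ ih =>
    obtain ⟨n, rfl⟩ := Nat.exists_eq_add_of_le' hmn
    exact .step (ih (Nat.le_add_left _ _))

theorem Reach.trans {R : Routine K} {l l' l'' : Option R.Label} {s s' s'' : Store K} {m n : ℕ}
    (h : R.Reach l' s' m l s) (h' : R.Reach l'' s'' n l' s') : R.Reach l'' s'' (m + n) l s := by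
  induction h with
  | refl => exact h'.mono (by omega)
  | step _ ih => exact Reach.mono (.step ih) (by omega)

theorem Runs.mono {R : Routine K} {s s' : Store K} {m n : ℕ}
    (h : R.Runs m s s') (hmn : m ≤ n) : R.Runs n s s' := Reach.mono h hmn

/-- One action pushes at most one symbol. The running time of the reduction therefore also bounds
the size of the instance it writes. -/
theorem Reach.length_le {R : Routine K} {l l' : Option R.Label} {s s' : Store K} {n : ℕ}
    (h : R.Reach l' s' n l s) (k : K) : (s' k).length ≤ (s k).length + n := by
  induction h with
  | refl => omega
  | @step n l s _ ih =>
    refine ih.trans ?_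
    have : ((R.act l).exec s k).length ≤ (s k).length + 1 := by
      cases R.act l with
      | push j a _ => by_cases h : k = j <;> simp [Action.exec, h]
      | pop j _ =>
        by_cases h : k = j
        · subst h; simp [Action.exec]; omega
        · simp [Action.exec, h]
    omega

/-- A routine keeps its runs when it is a relabelled part of a larger one whose control continues at
`e` after the part is left. Composition and loops are both instances. -/
theorem Reach.embed {R R' : Routine K} (φ : R.Label → R'.Label) (e : Option R'.Label)
    (h : ∀ l, R'.act (φ l) = (R.act l).map fun o => o.elim e fun x => some (φ x))
    {l l' : Option R.Label} {s s' : Store K} {n : ℕ} (hr : R.Reach l' s' n l s) :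
    R'.Reach (l'.elim e fun x => some (φ x)) s' n (l.elim e fun x => some (φ x)) s := by
  induction hr with
  | refl n => exact .refl n
  | @step n l s _ ih =>
    refine .step ?_
    rw [h, Action.target_map, Action.exec_map]
    exact ih

/-- The routine that does nothing. -/
def skip : Routine K where
  Label := Empty
  entry := none
  act := Empty.elim

/-- Push the symbol `a` on the stack `k`. -/
def push (k : K) (a : Sym) : Routine K where
  Label := Unit
  entry := some ()
  act _ := .push k a none

/-- Sequential composition. -/
def seq (R₁ R₂ : Routine K) : Routine K where
  Label := R₁.Label ⊕ R₂.Label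
  entry := R₁.entry.elim (R₂.entry.map Sum.inr) fun x => some (.inl x)
  act
    | .inl l => (R₁.act l).map fun o => o.elim (R₂.entry.map Sum.inr) fun x => some (.inl x)
    | .inr l => (R₂.act l).map fun o => o.elim none fun x => some (.inr x)

notation:60 R:61 ";;" S:60 => seq R S

/-- Repeatedly pop a symbol from `k` and run the body chosen by it, until the flag of a body
says to stop. -/
def loop (k : K) (body : Option Sym → Bool × Routine K) : Routine K where
  Label := Unit ⊕ Σ o, (body o).2.Label
  entry := some (.inl ())
  act
    | .inl _ => .pop k fun o =>
        (body o).2.entry.elim (if (body o).1 then some (.inl ()) else none)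
          fun x => some (.inr ⟨o, x⟩)
    | .inr ⟨o, l⟩ => ((body o).2.act l).map fun r =>
        r.elim (if (body o).1 then some (.inl ()) else none) fun x => some (.inr ⟨o, x⟩)

theorem skip_runs (s : Store K) : skip.Runs 0 s s := .refl 0

theorem push_runs (k : K) (a : Sym) (s : Store K) :
    (push k a).Runs 1 s (Function.update s k (a :: s k)) := .step (.refl 0)

theorem Runs.seq {R₁ R₂ : Routine K} {s s' s'' : Store K} {m n : ℕ}
    (h₁ : R₁.Runs m s s') (h₂ : R₂.Runs n s' s'') : (R₁ ;; R₂).Runs (m + n) s s'' := by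
  refine Reach.trans (Reach.embed (R' := R₁ ;; R₂) Sum.inl (R₂.entry.map Sum.inr)
    (fun _ => rfl) h₁) ?_
  have := Reach.embed (R' := R₁ ;; R₂) Sum.inr none (fun _ => rfl) h₂
  have he : (R₂.entry.elim none fun x => some (Sum.inr x)) =
      (R₂.entry.map Sum.inr : Option (R₁ ;; R₂).Label) := by
    cases R₂.entry <;> rfl
  exact (congrArg (fun e => (R₁ ;; R₂).Reach none s'' n e s') he).mp this

/-- The loop contains a separate copy of the body for each popped symbol, so the branch taken is
remembered in the label. The extra step is the pop. -/
theorem loop_body {k : K} {body : Option Sym → Bool × Routine K} {s s' : Store K} {t : ℕ}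
    (h : (body (s k).head?).2.Runs t (Function.update s k (s k).tail) s') :
    (loop k body).Reach (if (body (s k).head?).1 then (loop k body).entry else none) s' (t + 1)
      (loop k body).entry s :=
  .step (Reach.embed (R' := loop k body) (fun x => Sum.inr ⟨_, x⟩)
    (if (body (s k).head?).1 then some (.inl ()) else none) (fun _ => rfl) h)

theorem loop_exit {k : K} {body : Option Sym → Bool × Routine K} {s s' : Store K} {t : ℕ}
    (hb : (body (s k).head?).1 = false)
    (h : (body (s k).head?).2.Runs t (Function.update s k (s k).tail) s') :
    (loop k body).Runs (t + 1) s s' := by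
  have := loop_body h
  rwa [hb] at this

theorem loop_next {k : K} {body : Option Sym → Bool × Routine K} {s s' s'' : Store K} {t t' : ℕ}
    (hb : (body (s k).head?).1 = true)
    (h : (body (s k).head?).2.Runs t (Function.update s k (s k).tail) s')
    (h' : (loop k body).Runs t' s' s'') :
    (loop k body).Runs (t + 1 + t') s s'' := by
  have := loop_body h
  rw [hb] at this
  exact Reach.trans this h'

end Routine

/-! ### Running a routine in front of a Turing machine -/

open Turing

variable {K : Type} [DecidableEq K]

/-- The stacks of a routine next to those of another machine. -/
def joinStacks {I : Type} {Γ : I → Type} (s : Store K) (S : ∀ k, List (Γ k)) :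
    ∀ k : K ⊕ I, List (Sum.elim (fun _ => Sym) Γ k)
  | .inl k => s k
  | .inr k => S k

theorem update_joinStacks_inl {I : Type} [DecidableEq I] {Γ : I → Type} (s : Store K)
    (S : ∀ k, List (Γ k)) (k : K) (l : List Sym) :
    Function.update (joinStacks s S) (.inl k) l = joinStacks (Function.update s k l) S := by
  funext j
  rcases j with j | j
  · by_cases h : j = k
    · subst h
      exact (Function.update_self _ _ _).trans (by simp [joinStacks])
    · exact (Function.update_of_ne (by simpa using h) _ _).trans
        (Function.update_of_ne h _ _).symm
  · exact Function.update_of_ne (by simp) _ _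

theorem update_joinStacks_inr {I : Type} [DecidableEq I] {Γ : I → Type} (s : Store K)
    (S : ∀ k, List (Γ k)) (k : I) (l : List (Γ k)) :
    Function.update (joinStacks s S) (.inr k) l = joinStacks s (Function.update S k l) := by
  funext j
  rcases j with j | j
  · exact Function.update_of_ne (by simp) _ _
  · by_cases h : j = k
    · subst h
      exact (Function.update_self _ _ _).trans (by simp [joinStacks])
    · exact (Function.update_of_ne (by simpa using h) _ _).trans
        (Function.update_of_ne h _ _).symm

/-- A statement of a machine, as a statement of the machine preceded by a routine. -/
def liftStmt {I Λ σ Label : Type} {Γ : I → Type} :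
    TM2.Stmt Γ Λ σ →
      TM2.Stmt (Sum.elim (fun _ : K => Sym) Γ) (Option Label ⊕ Λ) (Option Sym × σ)
  | .push k f q => .push (.inr k) (fun v => f v.2) (liftStmt q)
  | .peek k f q => .peek (.inr k) (fun v o => (v.1, f v.2 o)) (liftStmt q)
  | .pop k f q => .pop (.inr k) (fun v o => (v.1, f v.2 o)) (liftStmt q)
  | .load f q => .load (fun v => (v.1, f v.2)) (liftStmt q)
  | .branch f q r => .branch (fun v => f v.2) (liftStmt q) (liftStmt r)
  | .goto f => .goto fun v => .inr (f v.2)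
  | .halt => .halt

/-- The register that receives the popped symbols of the routine is fixed to `none`, its initial
value, because a halting configuration must have the initial state. -/
def liftCfg {I Λ σ : Type} {Γ : I → Type} (Label : Type) (s : Store K) (c : TM2.Cfg Γ Λ σ) :
    TM2.Cfg (Sum.elim (fun _ : K => Sym) Γ) (Option Label ⊕ Λ) (Option Sym × σ) :=
  ⟨c.l.map .inr, (none, c.var), joinStacks s c.stk⟩

theorem stepAux_liftStmt {I Λ σ Label : Type} [DecidableEq I] {Γ : I → Type}
    (q : TM2.Stmt Γ Λ σ) (s : Store K) (v : σ) (S : ∀ k, List (Γ k)) :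
    TM2.stepAux (liftStmt (Label := Label) q) (none, v) (joinStacks s S) =
      liftCfg Label s (TM2.stepAux q v S) := by
  induction q generalizing v S with
  | push k f q ih =>
    simp only [liftStmt, TM2.stepAux]
    rw [← ih, ← update_joinStacks_inr]; rfl
  | peek k f q ih =>
    simp only [liftStmt, TM2.stepAux]
    rw [← ih]; rfl
  | pop k f q ih =>
    simp only [liftStmt, TM2.stepAux]
    rw [← ih, ← update_joinStacks_inr]; rfl
  | load f q ih => simp only [liftStmt, TM2.stepAux, ih]
  | branch f q r ih₁ ih₂ =>
    simp only [liftStmt, TM2.stepAux]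
    cases f v <;> simp [ih₁, ih₂]
  | goto f => rfl
  | halt => rfl

/-- The machine that runs the routine `R`, moves the stack `out` to the input stack of `M`, reversing
it, and then runs `M`. -/
def precompose [Fintype K] (R : Routine K) (inp out : K)
    (M : TM2ComputableAux Sym Bool) : TM2ComputableAux Sym Bool where
  tm :=
    { K := K ⊕ M.tm.K
      kFin := letI := M.tm.kFin; inferInstance
      kDecidableEq := inferInstance
      k₀ := .inl inp
      k₁ := .inr M.tm.k₁
      Γ := Sum.elim (fun _ => Sym) M.tm.Γ
      Λ := Option R.Label ⊕ M.tm.Λ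
      ΛFin := letI := M.tm.ΛFin; inferInstance
      main := .inl R.entry
      σ := Option Sym × M.tm.σ
      σFin := letI := M.tm.σFin; inferInstance
      initialState := (none, M.tm.initialState)
      Γk₀Fin := inferInstanceAs (Fintype Sym)
      m := fun
        | .inl (some l) =>
          match R.act l with
          | .push k a n => .push (.inl k) (fun _ => a) (.goto fun _ => .inl n)
          | .pop k n => .pop (.inl k) (fun v o => (o, v.2)) (.goto fun v => .inl (n v.1))
        -- The pop that finds `out` empty ends the transfer and also resets the register to `none`.
        | .inl none =>
          .pop (.inl out) (fun v o => (o, v.2))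
            (.branch (fun v => v.1.isSome)
              (.push (.inr M.tm.k₀) (fun v => M.inputAlphabet.symm (v.1.getD none))
                (.goto fun _ => .inl none))
              (.goto fun _ => .inr M.tm.main))
        | .inr l => liftStmt (M.tm.m l) }
  inputAlphabet := Equiv.refl Sym
  outputAlphabet := M.outputAlphabet

/-- Running a partial step function for `n` steps. -/
theorem flip_bind_iterate_add {C : Type} (f : C → Option C) {a b : C} {c : Option C} {m n : ℕ}
    (h : (flip bind f)^[m] (some a) = some b) (h' : (flip bind f)^[n] (some b) = c) :
    (flip bind f)^[m + n] (some a) = c := by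
  rw [Nat.add_comm, Function.iterate_add_apply, h, h']

section precompose

variable [Fintype K] (R : Routine K) (inp out : K) (M : TM2ComputableAux Sym Bool)

/-- A configuration of the combined machine in its first two phases. -/
def routineCfg (l : Option R.Label) (o : Option Sym) (s : Store K)
    (S : ∀ k, List (M.tm.Γ k)) : (precompose R inp out M).tm.Cfg :=
  ⟨some (.inl l), (o, M.tm.initialState), joinStacks s S⟩

/-- Each action is one machine step. The register ends up with whatever was popped last, hence the
existential over it. -/
theorem precompose_routine {l : Option R.Label} {s s' : Store K} {n : ℕ}
    (h : R.Reach none s' n l s) (S : ∀ k, List (M.tm.Γ k)) (o : Option Sym) :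
    ∃ m ≤ n, ∃ o', (flip bind (precompose R inp out M).tm.step)^[m]
      (some (routineCfg R inp out M l o s S)) = some (routineCfg R inp out M none o' s' S) := by
  induction h generalizing o with
  | refl n => exact ⟨0, Nat.zero_le _, o, rfl⟩
  | @step n l s _ ih =>
    have key : ∃ o', (flip bind (precompose R inp out M).tm.step)^[1]
        (some (routineCfg R inp out M (some l) o s S)) =
        some (routineCfg R inp out M ((R.act l).target s) o' ((R.act l).exec s) S) := by
      cases hA : R.act l with
      | push k a n =>
        refine ⟨o, ?_⟩
        have : joinStacks (Function.update s k (a :: s k)) S = _ :=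
          (update_joinStacks_inl s S k (a :: s k)).symm
        simp only [Action.target, Action.exec, routineCfg]
        rw [this]
        change some (TM2.stepAux _ _ _) = _
        simp only [precompose, hA]
        rfl
      | pop k n =>
        refine ⟨(s k).head?, ?_⟩
        have : joinStacks (Function.update s k (s k).tail) S = _ :=
          (update_joinStacks_inl s S k (s k).tail).symm
        simp only [Action.target, Action.exec, routineCfg]
        rw [this]
        change some (TM2.stepAux _ _ _) = _
        simp only [precompose, hA]
        rfl
    obtain ⟨o', ho'⟩ := key
    obtain ⟨m, hm, o'', h''⟩ := ih o'
    exact ⟨1 + m, by omega, o'', flip_bind_iterate_add _ ho' h''⟩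

/-- One step per symbol, and one for the pop that detects the bottom. The reversal compensates for
`out` carrying the last written symbol on top. -/
theorem precompose_transfer (w : List Sym) {s : Store K} (hs : s out = w)
    (S : ∀ k, List (M.tm.Γ k)) (o : Option Sym) :
    (flip bind (precompose R inp out M).tm.step)^[w.length + 1]
      (some (routineCfg R inp out M none o s S)) =
    some (⟨some (.inr M.tm.main), (none, M.tm.initialState),
      joinStacks (Function.update s out [])
        (Function.update S M.tm.k₀ (w.reverse.map M.inputAlphabet.symm ++ S M.tm.k₀))⟩ :
      (precompose R inp out M).tm.Cfg) := by
  induction w generalizing s S o with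
  | nil =>
    have h1 : joinStacks (Function.update s out []) S = _ :=
      (update_joinStacks_inl s S out []).symm
    simp only [List.reverse_nil, List.map_nil, List.nil_append, Function.update_eq_self]
    rw [h1]
    change some (TM2.stepAux _ _ _) = _
    simp only [precompose, TM2.stepAux, joinStacks, hs]
    rfl
  | cons a w ih =>
    rw [List.length_cons, Nat.add_comm (w.length + 1) 1]
    refine flip_bind_iterate_add _ (b := routineCfg R inp out M none (some a)
      (Function.update s out w)
      (Function.update S M.tm.k₀ (M.inputAlphabet.symm a :: S M.tm.k₀))) ?_ ?_
    · change some (TM2.stepAux _ _ _) = _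
      have h1 := update_joinStacks_inr (Function.update s out w) S M.tm.k₀
        (M.inputAlphabet.symm a :: S M.tm.k₀)
      have h2 := update_joinStacks_inl s S out w
      simp only [routineCfg]
      rw [← h1, ← h2]
      simp only [precompose, TM2.stepAux, joinStacks, hs]
      rfl
    · rw [ih (by simp)]
      simp
      rfl

theorem precompose_machine {n : ℕ} {c c' : M.tm.Cfg} (s : Store K)
    (h : (flip bind M.tm.step)^[n] (some c) = some c') :
    (flip bind (precompose R inp out M).tm.step)^[n]
      (some (liftCfg R.Label s c : (precompose R inp out M).tm.Cfg)) =
    some (liftCfg R.Label s c' : (precompose R inp out M).tm.Cfg) := by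
  induction n generalizing c with
  | zero =>
    have : c = c' := by simpa using h
    rw [this]; rfl
  | succ n ih =>
    rw [Function.iterate_succ_apply] at h ⊢
    obtain ⟨_ | l, v, S⟩ := c
    -- A halted configuration has no successor, so no further configuration can be reached from it.
    · change (flip bind M.tm.step)^[n] none = some c' at h
      have hn : ∀ n : ℕ, (flip bind M.tm.step)^[n] none = none := fun n => by
        induction n with
        | zero => rfl
        | succ n ih => rw [Function.iterate_succ_apply]; exact ih
      rw [hn] at h
      cases h
    · have h' := ih h
      rw [← h']
      congr 1
      change some (TM2.stepAux _ _ _) = _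
      exact congrArg some (stepAux_liftStmt (Label := R.Label) (M.tm.m l) s v S)

theorem joinStacks_initList (w : List Sym) :
    (initList (precompose R inp out M).tm w).stk =
      joinStacks (Function.update (fun _ => []) inp w) (fun _ : M.tm.K => []) := by
  funext k
  rcases k with k | k
  · by_cases h : k = inp
    · subst h; simp [initList, joinStacks, precompose]; rfl
    · simp [initList, joinStacks, precompose, h]
  · simp [initList, joinStacks, precompose]

/-- If `R` computes `w'` from `w` within `t` steps and `M` answers `b` on `w'` within `t'` steps, then
the combined machine answers `b` on `w`. -/
theorem precompose_outputs {w w' : List Sym} {b : Bool} {t t' : ℕ}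
    (hR : R.Runs t (Function.update (fun _ => []) inp w)
      (Function.update (fun _ => []) out w'.reverse))
    (hM : Nonempty (TM2OutputsInTime M.tm (w'.map M.inputAlphabet.symm)
      (some ([b].map M.outputAlphabet.symm)) t')) :
    Nonempty (TM2OutputsInTime (precompose R inp out M).tm
      (w.map (precompose R inp out M).inputAlphabet.symm)
      (some ([b].map (precompose R inp out M).outputAlphabet.symm)) (t + (w'.length + 1) + t')) := by
  obtain ⟨⟨⟨n, hn⟩, hn'⟩⟩ := hM
  obtain ⟨m, hm, o, hmo⟩ := precompose_routine R inp out M hR (fun _ => []) none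
  have h2 := precompose_transfer R inp out M w'.reverse
    (s := Function.update (fun _ => []) out w'.reverse) (by simp) (fun _ => []) o
  have h3 := precompose_machine R inp out M (fun _ => []) hn
  rw [List.length_reverse] at h2
  have h12 := flip_bind_iterate_add _ hmo h2
  have hmid : (⟨some (.inr M.tm.main), (none, M.tm.initialState),
      joinStacks (Function.update (Function.update (fun _ => []) out w'.reverse) out [])
        (Function.update (fun _ => []) M.tm.k₀
          (w'.reverse.reverse.map M.inputAlphabet.symm ++ []))⟩ :
      (precompose R inp out M).tm.Cfg) =
      (liftCfg R.Label (fun _ => []) (initList M.tm (w'.map M.inputAlphabet.symm))) := by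
    simp only [liftCfg, initList, Option.map_some]
    congr 2
    · funext k; by_cases h : k = out <;> simp [h]
    · funext k
      by_cases h : k = M.tm.k₀
      · subst h; simp
      · simp [h]
  have h123 := flip_bind_iterate_add _ h12 ((congrArg (fun c => (flip bind
    (precompose R inp out M).tm.step)^[n] (some c)) hmid).trans h3)
  refine ⟨⟨⟨m + (w'.length + 1) + n, ?_⟩, ?_⟩⟩
  · refine Eq.trans ?_ (h123.trans ?_)
    · congr 2
      have hi := joinStacks_initList R inp out M w
      have hw : w.map (precompose R inp out M).inputAlphabet.symm = w :=
        List.map_id w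
      rw [hw]
      simp only [routineCfg]
      rw [← hi]
      rfl
    · simp only [Option.map_some]
      congr 1
      simp only [liftCfg, haltList]
      congr 1
      funext k
      rcases k with k | k
      · simp [joinStacks, precompose]
      · by_cases h : k = M.tm.k₁
        · subst h; simp [joinStacks, precompose]; rfl
        · simp [joinStacks, precompose, h]
  · change m + (w'.length + 1) + n ≤ _
    have : n ≤ t' := hn'
    omega

end precompose

/-! ### Bit words and loops over them -/

/-- A word of bits as stack contents. -/
def bits (l : List Bool) : List Sym := l.map some

theorem bits_cons (b : Bool) (l : List Bool) : bits (b :: l) = some b :: bits l := rfl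

theorem bits_append (l l' : List Bool) : bits (l ++ l') = bits l ++ bits l' := List.map_append

theorem bits_reverse (l : List Bool) : (bits l).reverse = bits l.reverse := List.map_reverse.symm

theorem length_bits (l : List Bool) : (bits l).length = l.length := List.length_map _

/-- The successor of a binary number, least significant bit first; a carry out of the last digit
is appended or dropped. -/
def increment (grow : Bool) : List Bool → List Bool
  | [] => if grow then [true] else []
  | true :: l => false :: increment grow l
  | false :: l => true :: l

namespace Routine

open Function (update)

variable {K : Type} [DecidableEq K]

theorem Runs.congr {R : Routine K} {t t' : ℕ} {s s' s'' : Store K} (h : R.Runs t s s')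
    (ht : t ≤ t') (hs : s' = s'') : R.Runs t' s s'' := hs ▸ h.mono ht

/-- Pop a symbol and continue with the routine it selects. -/
def popCase (k : K) (f : Option Sym → Routine K) : Routine K := loop k fun o => (false, f o)

/-- Go through the bits on top of the stack `k` up to a separator or the bottom. -/
def forBits (k : K) (body : Bool → Routine K) : Routine K :=
  loop k fun
    | some (some b) => (true, body b)
    | _ => (false, skip)

/-- Move the contents of `k` to `T`, reversing them. -/
def move (k T : K) : Routine K :=
  loop k fun
    | some a => (true, push T a)
    | none => (false, skip)

/-- Empty the stack `k`. -/
def clear (k : K) : Routine K :=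
  loop k fun
    | some _ => (true, skip)
    | none => (false, skip)

/-- Go through the bits on the stack `k` and leave `k` as it was, using the auxiliary stack `T`. -/
def each (k T : K) (body : Bool → Routine K) : Routine K :=
  forBits k (fun b => body b ;; push T (some b)) ;; move T k

/-- Set all bits on the stack `k` to zero. -/
def zero (k T : K) : Routine K := forBits k (fun _ => push T (some false)) ;; move T k

/-- Make the last symbol on the stack `k` the first one. -/
def rotate (k T : K) : Routine K :=
  move k T ;; popCase T fun
    | some a => move T k ;; push k a
    | none => skip

/-- Increment the binary number on the stack `k`. -/
def inc (grow : Bool) (k T : K) : Routine K :=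
  (loop k fun
    | some (some true) => (true, push T (some false))
    | some (some false) => (false, push k (some true))
    | _ => (false, if grow then push k (some true) else skip)) ;; move T k

theorem popCase_runs {k : K} {f : Option Sym → Routine K} {s s' : Store K} {t : ℕ}
    (h : (f (s k).head?).Runs t (update s k (s k).tail) s') :
    (popCase k f).Runs (t + 1) s s' :=
  loop_exit rfl h

/-- `g m` describes the other stacks after `m` rounds. The body is required to work for any contents
`x` of `k`, since the unread part of the word changes from round to round. The final `r.tail`
reflects that the separator is consumed. -/
theorem forBits_runs {k : K} {body : Bool → Routine K} {l : List Bool} {r : List Sym}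
    (hr : r.head? = none ∨ r.head? = some none) {g : ℕ → Store K} {t : ℕ}
    (h : ∀ m b x, l[m]? = some b → (body b).Runs t (update (g m) k x) (update (g (m + 1)) k x)) :
    (forBits k body).Runs (l.length * (t + 1) + 1) (update (g 0) k (bits l ++ r))
      (update (g l.length) k r.tail) := by
  induction l generalizing g with
  | nil =>
    rw [List.length_nil, Nat.zero_mul]
    refine loop_exit ?_ ?_
    · rcases hr with hr | hr <;> simp [bits, hr]
    · rcases hr with hr | hr <;> simpa [bits, hr] using skip_runs _
  | cons b l ih =>
    have ih' := ih (g := fun m => g (m + 1)) fun m b' x hm => h (m + 1) b' x (by simpa using hm)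
    have h0 := h 0 b (bits l ++ r) (by simp)
    refine (loop_next (t := t) (s' := update (g 1) k (bits l ++ r)) ?_ ?_ ih').mono ?_
    · simp [bits]
    · simpa [bits] using h0
    · simp only [List.length_cons]; ring_nf; omega

theorem move_runs {k T : K} (hkT : k ≠ T) {s : Store K} {w : List Sym} (hw : s k = w) :
    (move k T).Runs (2 * w.length + 1) s (update (update s k []) T (w.reverse ++ s T)) := by
  induction w generalizing s with
  | nil =>
    refine loop_exit (by simp [hw]) ?_
    rw [hw]
    exact (skip_runs _).congr le_rfl (by simp [hkT.symm])
  | cons a w ih =>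
    have ih' := ih (s := update (update s k w) T (a :: s T)) (by simp [hkT])
    refine (loop_next (by simp [hw]) (s' := update (update s k w) T (a :: s T)) ?_ ih').congr
      (t := 1 + 1 + (2 * w.length + 1)) ?_ ?_
    · rw [hw]
      exact (push_runs _ _ _).congr le_rfl (by simp [hkT.symm])
    · simp only [List.length_cons]; omega
    · funext j
      by_cases h : j = T
      · subst h; simp
      · by_cases h' : j = k
        · subst h'; simp [hkT]
        · simp [h, h']

theorem clear_runs {k : K} {s : Store K} {w : List Sym} (hw : s k = w) :
    (clear k).Runs (w.length + 1) s (update s k []) := by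
  induction w generalizing s with
  | nil =>
    refine loop_exit (by simp [hw]) ?_
    rw [hw]
    exact skip_runs _
  | cons a w ih =>
    have ih' := ih (s := update s k w) (by simp)
    refine (loop_next (by simp [hw]) (s' := update s k w) ?_ ih').congr
      (t := 0 + 1 + (w.length + 1)) ?_ (by simp)
    · rw [hw]
      exact skip_runs _
    · simp only [List.length_cons]; omega

theorem each_runs {k T : K} (hkT : k ≠ T) {body : Bool → Routine K} {l : List Bool}
    {g : ℕ → Store K} {t B : ℕ} (hl : l.length ≤ B)
    (h : ∀ m b x y, l[m]? = some b → (body b).Runs t (update (update (g m) k x) T y)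
      (update (update (g (m + 1)) k x) T y)) :
    (each k T body).Runs (B * (t + 4) + 2) (update (update (g 0) k (bits l)) T [])
      (update (update (g l.length) k (bits l)) T []) := by
  have h1 := forBits_runs (k := k) (body := fun b => body b ;; push T (some b)) (l := l) (r := [])
    (t := t + 1) (Or.inl rfl) (g := fun m => update (g m) T (bits (l.take m).reverse)) (by
      intro m b x hm
      have h2 := h m b x (bits (l.take m).reverse) hm
      rw [Function.update_comm hkT] at h2
      refine (h2.seq (push_runs _ _ _)).congr le_rfl ?_
      have h3 : l.take (m + 1) = l.take m ++ [b] := by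
        rw [List.take_add_one, hm]; rfl
      rw [h3, List.reverse_append, List.reverse_singleton, List.singleton_append, bits_cons]
      funext j
      by_cases h : j = T
      · subst h; simp [hkT.symm]
      · by_cases h' : j = k
        · subst h'; simp [hkT]
        · simp [h, h'])
  have h3 := h1.seq (move_runs hkT.symm (w := (bits l).reverse) (k := T) (T := k) (by
    simp [hkT.symm, bits_reverse]))
  have e0 : update (update (g 0) T (bits (l.take 0).reverse)) k (bits l ++ []) =
      update (update (g 0) k (bits l)) T [] := by
    rw [Function.update_comm hkT]; simp [bits]
  rw [e0] at h3
  refine h3.congr ?_ ?_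
  · rw [List.length_reverse, length_bits]
    calc _ = l.length * (t + 4) + 2 := by ring
      _ ≤ _ := by gcongr
  · funext j
    by_cases h : j = T
    · subst h; simp [hkT.symm]
    · by_cases h' : j = k
      · subst h'; simp [hkT, bits_reverse]
      · simp [h, h']

theorem zero_runs {k T : K} (hkT : k ≠ T) {l : List Bool} {s : Store K} {B : ℕ}
    (hl : l.length ≤ B) (hk : s k = bits l) (hT : s T = []) :
    (zero k T).Runs (4 * B + 2) s (update s k (bits (List.replicate l.length false))) := by
  have h1 := forBits_runs (k := k) (body := fun b => push T (some false)) (l := l) (r := [])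
    (t := 1) (Or.inl rfl) (g := fun m => update s T (bits (List.replicate m false))) (by
      intro m b x _
      refine (push_runs _ _ _).congr le_rfl ?_
      rw [List.replicate_succ, bits_cons, Function.update_comm hkT]
      simp [hkT.symm])
  have h3 := h1.seq (move_runs hkT.symm (w := bits (List.replicate l.length false))
    (k := T) (T := k) (by simp [hkT.symm]))
  have e0 : update (update s T (bits (List.replicate 0 false))) k (bits l ++ []) = s := by
    funext j
    by_cases h : j = k
    · subst h; simp [hk]
    · by_cases h' : j = T
      · subst h'; simp [h, hT, bits]
      · simp [h, h']
  rw [e0] at h3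
  refine h3.congr ?_ ?_
  · rw [length_bits, List.length_replicate]; omega
  · funext j
    by_cases h : j = k
    · subst h; simp [bits_reverse]
    · by_cases h' : j = T
      · subst h'; simp [h, hT]
      · simp [h, h']

theorem rotate_runs {k T : K} (hkT : k ≠ T) {l : List Bool} {b : Bool} {s : Store K} {B : ℕ}
    (hl : l.length ≤ B) (hk : s k = bits (l ++ [b])) (hT : s T = []) :
    (rotate k T).Runs (4 * B + 6) s (update s k (bits (b :: l))) := by
  have h1 := move_runs hkT hk
  rw [bits_reverse, List.reverse_append, hT, List.append_nil, List.reverse_singleton,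
    List.singleton_append, bits_cons] at h1
  refine (h1.seq (popCase_runs (t := 2 * l.length + 1 + 1)
    (s' := update s k (bits (b :: l))) ?_)).mono ?_
  · have h2 := (move_runs (k := T) (T := k) hkT.symm (w := bits l.reverse)
      (s := update (update s k []) T (bits l.reverse)) (by simp)).seq (push_runs k (some b) _)
    simp only [Function.update_self, List.head?_cons, List.tail_cons, Function.update_idem]
    refine h2.congr ?_ ?_
    · simp [length_bits]
    · funext j
      by_cases h : j = k
      · subst h; simp [bits_reverse, hkT, bits_cons]
      · by_cases h' : j = T
        · subst h'; simp [h, hT]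
        · simp [h, h']
  · simp only [bits, List.length_map, List.length_append, List.length_singleton]; omega

theorem inc_runs {grow : Bool} {k T : K} (hkT : k ≠ T) {l : List Bool} {s : Store K} {B : ℕ}
    (hl : l.length ≤ B) (hk : s k = bits l) (hT : s T = []) :
    (inc grow k T).Runs (4 * B + 3) s (update s k (bits (increment grow l))) := by
  -- `u` collects on `T` the digits that the carry has turned to zero; `v` is what is left on `k`
  -- when the carry stops.
  have key : ∃ u v, increment grow l = u.reverse ++ v ∧ u.length ≤ l.length ∧
      (loop k fun
        | some (some true) => (true, push T (some false))
        | some (some false) => (false, push k (some true))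
        | _ => (false, if grow then push k (some true) else skip)).Runs (2 * l.length + 2) s
          (update (update s k (bits v)) T (bits u ++ s T)) := by
    clear hT hl
    induction l generalizing s with
    | nil =>
      refine ⟨[], increment grow [], rfl, le_rfl, ?_⟩
      refine loop_exit (t := 1) (by simp [hk, bits]) ?_
      rw [hk]
      cases grow
      · exact (skip_runs _).congr (by omega) (by simp [bits, increment, hkT.symm])
      · exact (push_runs _ _ _).congr le_rfl (by simp [bits, increment, hkT.symm])
    | cons b l ih =>
      cases b
      · refine ⟨[], true :: l, rfl, Nat.zero_le _, ?_⟩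
        refine (loop_exit (t := 1) (by simp [hk, bits]) ?_).mono (by omega)
        rw [hk]
        exact (push_runs _ _ _).congr le_rfl (by simp [bits, hkT.symm])
      · obtain ⟨u, v, huv, hu, hr⟩ := ih (s := update (update s k (bits l)) T (some false :: s T))
          (by simp [hkT])
        refine ⟨u ++ [false], v, by simp [increment, huv], by simpa using hu, ?_⟩
        refine (loop_next (t := 1) (by simp [hk, bits]) ?_ hr).congr ?_ ?_
        · rw [hk]
          exact (push_runs _ _ _).congr le_rfl (by simp [bits, hkT.symm])
        · simp only [List.length_cons]; omega
        · funext j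
          by_cases h : j = T
          · subst h; simp [bits]
          · by_cases h' : j = k
            · subst h'; simp [h]
            · simp [h, h']
  obtain ⟨u, v, huv, hu, hr⟩ := key
  refine (hr.seq (move_runs hkT.symm (w := bits u) (by simp [hT]))).congr ?_ ?_
  · rw [length_bits]; omega
  · funext j
    by_cases h : j = k
    · subst h; simp [huv, bits_append, bits_reverse, hkT]
    · by_cases h' : j = T
      · subst h'; simp [h, hT]
      · simp [h, h']

/-! ### Routines that only write output -/

/-- On all stores that agree with `c` on the stacks in `D`, the routine has the only effect of
writing `w` to the stack `out`, within `t` steps. -/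
def Emits (R : Routine K) (out : K) (D : List K) (c : Store K) (w : List Sym) (t : ℕ) : Prop :=
  ∀ s : Store K, (∀ j ∈ D, s j = c j) → R.Runs t s (update s out (w.reverse ++ s out))

theorem Emits.mono {R : Routine K} {out : K} {D D' : List K} {c : Store K} {w : List Sym} {t t' : ℕ}
    (h : R.Emits out D c w t) (hD : D ⊆ D') (ht : t ≤ t') : R.Emits out D' c w t' :=
  fun s hs => (h s fun j hj => hs j (hD hj)).mono ht

theorem skip_emits (out : K) (D : List K) (c : Store K) : skip.Emits out D c [] 0 :=
  fun s _ => (skip_runs s).congr le_rfl (by simp)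

theorem push_emits (out : K) (D : List K) (c : Store K) (a : Sym) :
    (push out a).Emits out D c [a] 1 :=
  fun s _ => push_runs out a s

theorem Emits.seq {R₁ R₂ : Routine K} {out : K} {D : List K} {c : Store K} {w₁ w₂ : List Sym}
    {t₁ t₂ : ℕ} (hD : out ∉ D) (h₁ : R₁.Emits out D c w₁ t₁) (h₂ : R₂.Emits out D c w₂ t₂) :
    (R₁ ;; R₂).Emits out D c (w₁ ++ w₂) (t₁ + t₂) := by
  intro s hs
  refine ((h₁ s hs).seq (h₂ _ fun j hj => ?_)).congr le_rfl ?_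
  · rw [Function.update_of_ne (ne_of_mem_of_not_mem hj hD)]
    exact hs j hj
  · simp

/-- The invariant is that `out` has received the words of the bits read so far. Disjointness of the
loop stacks from `D` keeps the hypothesis of the body valid during the loop. -/
theorem Emits.each {k T out : K} {body : Bool → Routine K} {D : List K} {c : Store K}
    {l : List Bool} {w : Bool → List Sym} {t B : ℕ} (hk : c k = bits l) (hT : c T = [])
    (hd : (out :: T :: k :: D).Nodup) (hl : l.length ≤ B)
    (h : ∀ b, (body b).Emits out D c (w b) t) :
    (each k T body).Emits out (k :: T :: D) c (l.flatMap w) (B * (t + 4) + 2) := by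
  simp only [List.nodup_cons, List.mem_cons, not_or] at hd
  obtain ⟨⟨hoT, hok, hoD⟩, ⟨hTk, hTD⟩, hkD, -⟩ := hd
  intro s hs
  have hsk : s k = bits l := (hs k (by simp)).trans hk
  have hsT : s T = [] := (hs T (by simp)).trans hT
  have h1 := each_runs (Ne.symm hTk) (body := body) (l := l) (t := t) hl
    (g := fun m => update s out (((l.take m).flatMap w).reverse ++ s out)) (by
      intro m b x y hm
      refine (h b _ ?_).congr le_rfl ?_
      · intro j hj
        have hjT : j ≠ T := fun e => hTD (e ▸ hj)
        have hjk : j ≠ k := fun e => hkD (e ▸ hj)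
        have hjo : j ≠ out := fun e => hoD (e ▸ hj)
        simp [hjT, hjk, hjo, hs j (by simp [hj])]
      · have h3 : l.take (m + 1) = l.take m ++ [b] := by
          rw [List.take_add_one, hm]; rfl
        rw [h3]
        funext j
        by_cases h1 : j = out
        · subst h1; simp [hoT, hok]
        · by_cases h2 : j = T
          · subst h2; simp [h1]
          · by_cases h3 : j = k
            · subst h3; simp [h1, h2]
            · simp [h1, h2, h3])
  have e : ∀ x, update (update (update s out x) k (bits l)) T [] = update s out x := by
    intro x
    funext j
    by_cases h2 : j = T
    · subst h2; simp [hsT, Ne.symm hoT]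
    · by_cases h3 : j = k
      · subst h3; simp [h2, hsk, Ne.symm hok]
      · simp [h2, h3]
  rw [e, e] at h1
  simpa using h1

end Routine

/-! ### Writing vectors and sets of vectors -/

open Function (update)
open Routine

/-- The stacks used by the reduction from the clique problem. -/
inductive Stk
  | inp | out | unaryK | unaryK' | hotI | hotI' | hotE | hotE' | hotJ | hotJ'
  | unaryN | unaryN' | unaryM | unaryM' | idU | idV | tmp | adj'
  deriving DecidableEq

open Stk

instance : Fintype Stk where
  elems := {inp, out, unaryK, unaryK', hotI, hotI', hotE, hotE', hotJ, hotJ',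
    unaryN, unaryN', unaryM, unaryM', idU, idV, tmp, adj'}
  complete x := by cases x <;> decide

/-- The word of length `k` with a single one, at position `i`. -/
def hot (k i : ℕ) : List Bool := (List.range k).map fun a => decide (a = i)

theorem length_hot (k i : ℕ) : (hot k i).length = k := by simp [hot]

/-- An index below `k` is stored as a unit word, so that moving to the next index modulo `k` is a
cyclic shift. -/
theorem hot_rotate {k j : ℕ} (hj : j < k) :
    ∃ l b, l.length ≤ k ∧ hot k j = l ++ [b] ∧ hot k ((j + 1) % k) = b :: l := by
  obtain ⟨k, rfl⟩ := Nat.exists_eq_add_of_le' (Nat.one_le_of_lt hj)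
  refine ⟨(List.range k).map fun a => decide (a = j), decide (k = j), by simp, ?_, ?_⟩
  · simp [hot, List.range_succ]
  · rw [hot, List.range_succ_eq_map, List.map_cons, List.map_map]
    rcases Nat.lt_succ_iff_lt_or_eq.1 hj with h | h
    · rw [Nat.mod_eq_of_lt (by omega)]
      congr 1
      · simp; omega
      · refine List.map_congr_left fun a _ => ?_
        simp
    · subst h
      rw [Nat.mod_self]
      congr 1
      · simp
      · refine List.map_congr_left fun a ha => ?_
        have := List.mem_range.1 ha
        simp; omega

theorem replicate_false_hot {k : ℕ} {l : List Bool} (h : List.replicate k false = false :: l) :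
    hot k 0 = true :: l := by
  cases k with
  | zero => simp at h
  | succ k =>
    rw [List.replicate_succ, List.cons.injEq] at h
    rw [hot, List.range_succ_eq_map, List.map_cons, List.map_map, ← h.2]
    simp only [decide_true, List.cons.injEq, true_and]
    exact List.eq_replicate_iff.2 ⟨by simp, by simp⟩

/-- The identifier of the vertex `u` with `L` bits. -/
def idBits (L u : ℕ) : List Bool := (increment false)^[u] (List.replicate L false)

theorem length_increment_false (l : List Bool) : (increment false l).length = l.length := by
  induction l with
  | nil => rfl
  | cons b l ih => cases b <;> simp [increment, ih]

theorem length_idBits (L u : ℕ) : (idBits L u).length = L := by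
  induction u with
  | zero => simp [idBits]
  | succ u ih =>
    rw [idBits, Function.iterate_succ_apply', length_increment_false]
    exact ih

theorem idBits_succ (L u : ℕ) : idBits L (u + 1) = increment false (idBits L u) :=
  Function.iterate_succ_apply' _ _ _

/-- `p` if the flag is set, and zeros otherwise. -/
def mask (m : Bool) (p : List Bool) : List Bool := p.map (m && ·)

/-- One block of a vector. The flags `h` and `h'` tell whether it is in the row and in the column of
the set of the vector, `e` whether this set is on the diagonal, and `c` whether it is a first
copy. -/
def vecBlock (c e h h' : Bool) (p q : List Bool) : List Bool :=
  mask (c && (h && xor h' e)) p ++ (mask (c && (h' && xor h e)) q ++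
    (mask (h && h') p ++ mask (h && h') q))

/-- The bits of the vector for the pair of vertices with identifiers `p` and `q`. -/
def vecBits (c e : Bool) (H H' p q : List Bool) : List Bool :=
  H.flatMap fun h => H'.flatMap fun h' => vecBlock c e h h' p q

/-- The time for going through a stack. -/
def eachTime (B t : ℕ) : ℕ := B * (t + 4) + 2

/-- Write the bits on the stack `p`, masked. -/
def emitMasked (m : Bool) (p : Stk) : Routine Stk :=
  each p tmp fun b => push out (some (m && b))

/-- Write a vector, given the identifiers on the stacks `p` and `q`. -/
def emitVec (c e : Bool) (p q : Stk) : Routine Stk :=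
  push out (some true) ;; each hotI hotI' fun h => each hotJ hotJ' fun h' =>
    emitMasked (c && (h && xor h' e)) p ;; emitMasked (c && (h' && xor h e)) q ;;
    emitMasked (h && h') p ;; emitMasked (h && h') q

theorem emitMasked_emits {m : Bool} {p : Stk} (hp : p = idU ∨ p = idV) {c : Store Stk}
    {l : List Bool} {B : ℕ} (hl : l.length ≤ B) (hc : c p = bits l) (hT : c tmp = []) :
    (emitMasked m p).Emits out [idU, idV, tmp] c (bits (mask m l)) (eachTime B 1) := by
  have h := Emits.each (k := p) (T := tmp) (out := out) (D := []) (c := c) (t := 1)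
    (body := fun b => push out (some (m && b))) hc hT (by rcases hp with rfl | rfl <;> decide) hl
    fun b => push_emits out [] c _
  have e : (l.flatMap fun b => [some (m && b)]) = bits (mask m l) := by
    simp only [bits, mask, List.map_map, ← List.map_eq_flatMap]
    rfl
  rw [e] at h
  exact h.mono (by rcases hp with rfl | rfl <;> decide) le_rfl

def vecTime (B : ℕ) : ℕ :=
  1 + eachTime B (eachTime B (eachTime B 1 + (eachTime B 1 + (eachTime B 1 + eachTime B 1))))

theorem flatMap_bits {α : Type} (l : List α) (f : α → List Bool) :
    (l.flatMap fun a => bits (f a)) = bits (l.flatMap f) := by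
  simp [bits, List.map_flatMap]

theorem emitVec_emits {c e : Bool} {p q : Stk} (hp : p = idU ∨ p = idV) (hq : q = idU ∨ q = idV)
    {s : Store Stk} {H H' l l' : List Bool} {B : ℕ} (hH : H.length ≤ B) (hH' : H'.length ≤ B)
    (hl : l.length ≤ B) (hl' : l'.length ≤ B)
    (hsH : s hotI = bits H) (hsH' : s hotJ = bits H') (hsp : s p = bits l) (hsq : s q = bits l')
    (h1 : s hotI' = []) (h2 : s hotJ' = []) (h3 : s tmp = []) :
    (emitVec c e p q).Emits out [hotI, hotI', hotJ, hotJ', idU, idV, tmp] s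
      (some true :: bits (vecBits c e H H' l l')) (vecTime B) := by
  refine Emits.seq (w₁ := [some true])
    (w₂ := bits (vecBits c e H H' l l')) (by decide) (push_emits _ _ _ _) ?_
  have : bits (vecBits c e H H' l l') =
      H.flatMap fun h => H'.flatMap fun h' => bits (vecBlock c e h h' l l') := by
    rw [vecBits, ← flatMap_bits]
    congr 1
    funext h
    rw [← flatMap_bits]
  rw [this]
  refine Emits.each hsH h1 (by decide) hH fun h => Emits.each hsH' h2 (by decide) hH' fun h' => ?_
  rw [vecBlock, bits_append, bits_append, bits_append]
  exact (emitMasked_emits hp hl hsp h3).seq (by decide) <|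
    (emitMasked_emits hq hl' hsq h3).seq (by decide) <|
    (emitMasked_emits hp hl hsp h3).seq (by decide) (emitMasked_emits hq hl' hsq h3)

/-- Write the vectors of a set on the diagonal. -/
def emitDiag (c : Bool) : Routine Stk :=
  each unaryN unaryN' (fun _ => emitVec c true idU idU ;; inc false idU tmp) ;; zero idU tmp

/-- Write the vectors of a set off the diagonal. -/
def emitOff (c : Bool) : Routine Stk :=
  each unaryN unaryN' (fun _ =>
    each unaryM unaryM' (fun _ =>
      popCase inp (fun
        | some (some a) => (if a then emitVec c false idU idV else skip) ;; push adj' (some a)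
        | _ => skip) ;;
      inc false idV tmp) ;;
    zero idV tmp ;; inc false idU tmp) ;;
  zero idU tmp ;; move adj' inp

/-- Write a set. -/
def emitSet (c e : Bool) : Routine Stk :=
  (if e then emitDiag c else emitOff c) ;; push out none

/-- The encoded vectors of the diagonal set `(i, i)`, before the final separator. -/
def diagWord (k N L : ℕ) (c : Bool) (i j : ℕ) : List Sym :=
  (List.range N).flatMap fun u =>
    some true :: bits (vecBits c true (hot k i) (hot k j) (idBits L u) (idBits L u))

/-- The encoded vectors of the set `(i, j)` off the diagonal, before the final separator. -/
def offWord (k N L : ℕ) (A : List Bool) (c : Bool) (i j : ℕ) : List Sym :=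
  (List.range N).flatMap fun u => (List.range N).flatMap fun v =>
    if A[u * N + v]? = some true then
      some true :: bits (vecBits c false (hot k i) (hot k j) (idBits L u) (idBits L v)) else []

/-- The encoding of the set `(i, j)`. -/
def setWord (k N L : ℕ) (A : List Bool) (c : Bool) (i j : ℕ) : List Sym :=
  (if i = j then diagWord k N L c i j else offWord k N L A c i j) ++ [none]

/-- The stacks while the sets are written. -/
def base (k N L : ℕ) (A : List Bool) (i j : ℕ) (w : List Sym) : Store Stk
  | inp => bits A
  | out => w
  | unaryK => bits (List.replicate k true)
  | hotI => bits (hot k i)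
  | hotE => bits (hot k i)
  | hotJ => bits (hot k j)
  | unaryN => bits (List.replicate N true)
  | unaryM => bits (List.replicate N true)
  | idU => bits (List.replicate L false)
  | idV => bits (List.replicate L false)
  | _ => []

/-- The stacks that matter for writing a set. -/
def setStacks : List Stk :=
  [inp, hotI, hotI', hotJ, hotJ', unaryN, unaryN', unaryM, unaryM', idU, idV, tmp, adj']

def diagTime (B : ℕ) : ℕ := eachTime B (vecTime B + (4 * B + 3)) + (4 * B + 2)

theorem flatMap_range_succ {α : Type} (f : ℕ → List α) (m : ℕ) :
    (List.range (m + 1)).flatMap f = (List.range m).flatMap f ++ f m := by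
  simp [List.range_succ]

theorem emitDiag_emits {k N L B : ℕ} (A : List Bool) (c : Bool) (i j : ℕ) (hk : k ≤ B) (hN : N ≤ B)
    (hL : L ≤ B) : (emitDiag c).Emits out setStacks (base k N L A i j [])
      (diagWord k N L c i j) (diagTime B) := by
  intro s hs
  simp only [setStacks, List.mem_cons, List.not_mem_nil, or_false, forall_eq_or_imp, forall_eq,
    base] at hs
  obtain ⟨s1, s2, s3, s4, s5, s6, s7, s8, s9, s10, s11, s12, s13⟩ := hs
  let word (u : ℕ) : List Sym :=
    some true :: bits (vecBits c true (hot k i) (hot k j) (idBits L u) (idBits L u))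
  have h1 := each_runs (k := unaryN) (T := unaryN') (by decide) (l := List.replicate N true)
    (body := fun _ => emitVec c true idU idU ;; inc false idU tmp) (B := B)
    (t := vecTime B + (4 * B + 3))
    (g := fun m => update (update s idU (bits (idBits L m))) out
      (((List.range m).flatMap word).reverse ++ s out)) (by simpa using hN) (by
      intro m b x y _
      refine ((emitVec_emits (H := hot k i) (H' := hot k j) (l := idBits L m) (l' := idBits L m)
        (B := B) (Or.inl rfl) (Or.inl rfl) ?_ ?_ ?_ ?_ ?_ ?_ ?_ ?_ ?_ ?_ ?_ _
        fun _ _ => rfl).seq (inc_runs (B := B) (l := idBits L m) (by decide) ?_ ?_ ?_)).congr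
          le_rfl ?_
      any_goals simp [length_hot, length_idBits, s2, s3, s4, s5, s12, hk, hL]
      funext j
      cases j <;> simp [idBits_succ, flatMap_range_succ, word])
  have h2 := h1.seq (zero_runs (k := idU) (T := tmp) (B := B) (l := idBits L N) (by decide)
    (by simpa [length_idBits]) (by simp) (by simpa using s12))
  have e0 : update (update (update (update s idU (bits (idBits L 0))) out
      (((List.range 0).flatMap word).reverse ++ s out)) unaryN (bits (List.replicate N true)))
      unaryN' [] = s := by
    funext j
    cases j <;> simp [s6, s7, s10, idBits]
  rw [e0] at h2
  refine h2.congr le_rfl ?_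
  funext j
  cases j <;> simp [s6, s7, s10, length_idBits, diagWord, word]

def rowTime (B : ℕ) : ℕ :=
  eachTime B (vecTime B + 1 + 1 + (4 * B + 3)) + (4 * B + 2 + (4 * B + 3))

def offTime (B : ℕ) : ℕ :=
  eachTime B (rowTime B) + (4 * B + 2 + (2 * (B * B) + 1))

/-- Invariant after column `m` of row `u`: `inp` holds the unread matrix entries from position `u *
N + m`, `adj'` the read ones in reverse, and `idV` the identifier of `m`. The entry just read
decides whether a vector is written. -/
theorem emitOff_row_runs {k N L B : ℕ} {A : List Bool} (c : Bool) {i j u : ℕ} (hA : A.length = N * N)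
    (hu : u < N) (hk : k ≤ B) (hN : N ≤ B) (hL : L ≤ B) {s : Store Stk}
    (s1 : s inp = bits (A.drop (u * N))) (s2 : s hotI = bits (hot k i)) (s3 : s hotI' = [])
    (s4 : s hotJ = bits (hot k j)) (s5 : s hotJ' = [])
    (s8 : s unaryM = bits (List.replicate N true)) (s9 : s unaryM' = [])
    (s10 : s idU = bits (idBits L u)) (s11 : s idV = bits (List.replicate L false))
    (s12 : s tmp = []) (s13 : s adj' = bits (A.take (u * N)).reverse) :
    (each unaryM unaryM' (fun _ =>
      popCase inp (fun
        | some (some a) => (if a then emitVec c false idU idV else skip) ;; push adj' (some a)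
        | _ => skip) ;;
      inc false idV tmp) ;;
    zero idV tmp ;; inc false idU tmp).Runs (rowTime B) s
      (update (update (update (update s inp (bits (A.drop ((u + 1) * N)))) adj'
        (bits (A.take ((u + 1) * N)).reverse)) idU (bits (idBits L (u + 1)))) out
        (((List.range N).flatMap fun v => if A[u * N + v]? = some true then some true ::
          bits (vecBits c false (hot k i) (hot k j) (idBits L u) (idBits L v)) else []).reverse ++
          s out)) := by
  let word (v : ℕ) : List Sym := if A[u * N + v]? = some true then some true ::
      bits (vecBits c false (hot k i) (hot k j) (idBits L u) (idBits L v)) else []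
  have h1 := each_runs (k := unaryM) (T := unaryM') (by decide) (l := List.replicate N true)
    (body := fun _ => popCase inp (fun
        | some (some a) => (if a then emitVec c false idU idV else skip) ;; push adj' (some a)
        | _ => skip) ;;
      inc false idV tmp) (B := B) (t := vecTime B + 1 + 1 + (4 * B + 3))
    (g := fun m => update (update (update (update s inp (bits (A.drop (u * N + m)))) adj'
        (bits (A.take (u * N + m)).reverse)) idV (bits (idBits L m))) out
      (((List.range m).flatMap word).reverse ++ s out)) (by simpa using hN) (by
      intro m b x y hm
      have hmN : m < N := by
        have := (List.getElem?_eq_some_iff.1 hm).1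
        simpa using this
      have hlt : u * N + m < A.length := by
        rw [hA]; nlinarith
      obtain ⟨a, ha⟩ : ∃ a, A[u * N + m]? = some a := ⟨_, List.getElem?_eq_getElem hlt⟩
      have hdrop : A.drop (u * N + m) = a :: A.drop (u * N + (m + 1)) := by
        rw [List.drop_eq_getElem_cons hlt, ← add_assoc]
        rw [List.getElem?_eq_getElem hlt] at ha
        rw [Option.some.inj ha]
      have htake : A.take (u * N + (m + 1)) = A.take (u * N + m) ++ [a] := by
        rw [← add_assoc, List.take_add_one, ha]; rfl
      have hvec := emitVec_emits (c := c) (e := false) (p := idU) (q := idV) (H := hot k i)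
        (H' := hot k j) (l := idBits L u) (l' := idBits L m) (B := B) (Or.inl rfl) (Or.inr rfl)
        (s := update (update (update (update (update (update s inp
          (bits (A.drop (u * N + (m + 1))))) adj' (bits (A.take (u * N + m)).reverse)) idV
          (bits (idBits L m))) out (((List.range m).flatMap word).reverse ++ s out)) unaryM x)
          unaryM' y)
        (by simpa [length_hot]) (by simpa [length_hot]) (by simpa [length_idBits])
        (by simpa [length_idBits]) (by simpa) (by simpa) (by simpa) (by simp) (by simpa)
        (by simpa) (by simpa)
      have hif : ((if a then emitVec c false idU idV else skip) : Routine Stk).Emits out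
          [hotI, hotI', hotJ, hotJ', idU, idV, tmp] (update (update (update (update (update
          (update s inp (bits (A.drop (u * N + (m + 1))))) adj' (bits (A.take (u * N + m)).reverse))
          idV (bits (idBits L m))) out (((List.range m).flatMap word).reverse ++ s out)) unaryM x)
          unaryM' y) (word m) (vecTime B) := by
        cases a
        · simpa [word, ha] using (skip_emits _ _ _).mono (List.Subset.refl _) (Nat.zero_le _)
        · simpa [word, ha] using hvec
      refine ((popCase_runs (t := vecTime B + 1) (s' := update (update (update (update (update
          (update s inp (bits (A.drop (u * N + (m + 1))))) adj'
          (bits (A.take (u * N + (m + 1))).reverse))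
          idV (bits (idBits L m))) out (((List.range (m + 1)).flatMap word).reverse ++ s out))
          unaryM x) unaryM' y) ?_).seq
        (inc_runs (k := idV) (T := tmp) (B := B) (l := idBits L m) (by decide) ?_ ?_ ?_)).congr
          le_rfl ?_
      · have hinp : (update (update (update (update (update (update s inp
          (bits (A.drop (u * N + m)))) adj' (bits (A.take (u * N + m)).reverse)) idV
          (bits (idBits L m))) out (((List.range m).flatMap word).reverse ++ s out)) unaryM x)
          unaryM' y) inp = some a :: bits (A.drop (u * N + (m + 1))) := by
          simp [hdrop, bits_cons]
        rw [hinp]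
        have := (hif _ fun _ _ => rfl).seq (push_runs adj' (some a) _)
        simp only [List.head?_cons, List.tail_cons]
        have e : (update (update (update (update (update (update (update s inp
          (bits (A.drop (u * N + m)))) adj' (bits (A.take (u * N + m)).reverse)) idV
          (bits (idBits L m))) out (((List.range m).flatMap word).reverse ++ s out)) unaryM x)
          unaryM' y) inp (bits (A.drop (u * N + (m + 1))))) = (update (update (update (update (update
          (update s inp (bits (A.drop (u * N + (m + 1))))) adj' (bits (A.take (u * N + m)).reverse))
          idV (bits (idBits L m))) out (((List.range m).flatMap word).reverse ++ s out)) unaryM x)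
          unaryM' y) := by
          funext j
          cases j <;> simp
        rw [e]
        refine this.congr le_rfl ?_
        funext j
        cases j <;> simp [htake, flatMap_range_succ, bits_cons]
      · simpa [length_idBits]
      · simp
      · simpa
      · funext j
        cases j <;> simp [idBits_succ])
  have h2 := h1.seq ((zero_runs (k := idV) (T := tmp) (B := B) (l := idBits L N) (by decide)
    (by simpa [length_idBits]) (by simp) (by simpa using s12)).seq
    (inc_runs (grow := false) (k := idU) (T := tmp) (B := B) (l := idBits L u) (by decide)
      (by simpa [length_idBits]) (by simpa) (by simpa)))
  have e0 : update (update (update (update (update (update s inp (bits (A.drop (u * N + 0)))) adj'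
        (bits (A.take (u * N + 0)).reverse)) idV (bits (idBits L 0))) out
      (((List.range 0).flatMap word).reverse ++ s out)) unaryM (bits (List.replicate N true)))
      unaryM' [] = s := by
    funext j
    cases j <;> simp [s1, s13, s11, s8, s9, idBits]
  rw [e0] at h2
  refine h2.congr le_rfl ?_
  funext j
  cases j <;> simp [s8, s9, s11, length_idBits, idBits_succ, word, add_mul]

theorem emitOff_emits {k N L B : ℕ} {A : List Bool} (c : Bool) (i j : ℕ) (hA : A.length = N * N)
    (hk : k ≤ B) (hN : N ≤ B) (hL : L ≤ B) :
    (emitOff c).Emits out setStacks (base k N L A i j []) (offWord k N L A c i j) (offTime B) := by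
  intro s hs
  simp only [setStacks, List.mem_cons, List.not_mem_nil, or_false, forall_eq_or_imp, forall_eq,
    base] at hs
  obtain ⟨s1, s2, s3, s4, s5, s6, s7, s8, s9, s10, s11, s12, s13⟩ := hs
  let word (u : ℕ) : List Sym := (List.range N).flatMap fun v =>
    if A[u * N + v]? = some true then some true ::
      bits (vecBits c false (hot k i) (hot k j) (idBits L u) (idBits L v)) else []
  have h1 := each_runs (k := unaryN) (T := unaryN') (by decide) (l := List.replicate N true)
    (body := fun _ => each unaryM unaryM' (fun _ =>
      popCase inp (fun
        | some (some a) => (if a then emitVec c false idU idV else skip) ;; push adj' (some a)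
        | _ => skip) ;;
      inc false idV tmp) ;;
    zero idV tmp ;; inc false idU tmp) (B := B) (t := rowTime B)
    (g := fun m => update (update (update (update s inp (bits (A.drop (m * N)))) adj'
        (bits (A.take (m * N)).reverse)) idU (bits (idBits L m))) out
      (((List.range m).flatMap word).reverse ++ s out)) (by simpa using hN) (by
      intro m b x y hm
      have hmN : m < N := by
        have := (List.getElem?_eq_some_iff.1 hm).1
        simpa using this
      refine (emitOff_row_runs (k := k) (L := L) (i := i) (j := j) c hA hmN hk hN hL ?_ ?_ ?_ ?_
        ?_ ?_ ?_ ?_ ?_ ?_ ?_).congr le_rfl ?_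
      any_goals simp [*]
      funext j
      cases j <;> simp [flatMap_range_succ, word])
  -- After the last row, the identifier is reset and the whole matrix is moved back from `adj'`,
  -- since every further set reads it again.
  have h2 := h1.seq ((zero_runs (k := idU) (T := tmp) (B := B) (l := idBits L N) (by decide)
    (by simpa [length_idBits]) (by simp) (by simpa using s12)).seq
    (move_runs (k := adj') (T := inp) (w := bits A.reverse) (by decide) (by
      simp [← hA])))
  have e0 : update (update (update (update (update (update s inp (bits (A.drop (0 * N)))) adj'
        (bits (A.take (0 * N)).reverse)) idU (bits (idBits L 0))) out
      (((List.range 0).flatMap word).reverse ++ s out)) unaryN (bits (List.replicate N true)))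
      unaryN' [] = s := by
    funext j
    cases j <;> simp [s1, s13, s10, s6, s7, idBits, bits]
  rw [e0] at h2
  refine h2.congr ?_ ?_
  · rw [offTime, eachTime, length_bits, List.length_reverse, hA]
    gcongr
  · funext j
    cases j <;> simp [s1, s6, s7, s10, s13, ← hA, bits, length_idBits, offWord, word]

def setTime (B : ℕ) : ℕ := diagTime B + offTime B + 1

theorem emitSet_emits {k N L B : ℕ} {A : List Bool} (c : Bool) (i j : ℕ) (hA : A.length = N * N)
    (hk : k ≤ B) (hN : N ≤ B) (hL : L ≤ B) :
    (emitSet c (decide (j = i))).Emits out setStacks (base k N L A i j [])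
      (setWord k N L A c i j) (setTime B) := by
  refine Emits.seq (t₁ := diagTime B + offTime B) (by decide) ?_ (push_emits _ _ _ _)
  by_cases h : i = j
  · subst h
    simpa using (emitDiag_emits A c i i hk hN hL).mono (List.Subset.refl _) (Nat.le_add_right _ _)
  · simpa [h, Ne.symm h] using
      (emitOff_emits c i j hA hk hN hL).mono (List.Subset.refl _) (Nat.le_add_left _ _)


/-! ### The complete reduction as a routine -/

open Function (update)
open Routine Stk

/-- Turn a word of zeros into a word with a one at the first position. -/
def mark (k : Stk) : Routine Stk :=
  popCase k fun
    | some _ => push k (some true)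
    | none => skip

theorem mark_runs {k : Stk} {s : Store Stk} {n : ℕ} (hk : s k = bits (List.replicate n false)) :
    (mark k).Runs 2 s (update s k (bits (hot n 0))) := by
  refine popCase_runs ?_
  cases n with
  | zero =>
    rw [hk]
    exact (skip_runs _).congr (by omega) (by simp [bits, hot])
  | succ n =>
    rw [hk, List.replicate_succ, bits_cons, replicate_false_hot List.replicate_succ]
    exact (push_runs _ _ _).congr le_rfl (by simp [bits_cons])

theorem Routine.Runs.of_eq {K : Type} [DecidableEq K] {R : Routine K} {t : ℕ} {s₀ s s' : Store K}
    (h : R.Runs t s s') (hs : s₀ = s) : R.Runs t s₀ s' := hs ▸ h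

/-- Read the parameter and the number of vertices. -/
def readInput : Routine Stk :=
  forBits inp (fun _ => push unaryK (some true) ;; push hotI (some false) ;;
    push hotE (some false) ;; push hotJ (some false)) ;;
  mark hotI ;; mark hotE ;; mark hotJ ;;
  forBits inp (fun _ => push unaryN (some true) ;; push unaryM (some true))

theorem encodeUnary_eq (m : ℕ) : encodeUnary m = bits (List.replicate m true) ++ [none] := by
  simp [encodeUnary, bits]

/-- The identifier length in the resulting store is 0, as the identifiers are set up only later. -/
theorem readInput_runs {k N B : ℕ} {A : List Bool} (hk : k ≤ B) (hN : N ≤ B) :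
    readInput.Runs (8 * B + 8) (update (fun _ => []) inp
      (encodeUnary k ++ (encodeUnary N ++ bits A))) (base k N 0 A 0 0 []) := by
  rw [encodeUnary_eq, encodeUnary_eq, List.append_assoc, List.append_assoc]
  let z (m : ℕ) : List Sym := bits (List.replicate m false)
  let o (m : ℕ) : List Sym := bits (List.replicate m true)
  have hz (m : ℕ) : z (m + 1) = some false :: z m := by
    simp only [z, List.replicate_succ, bits_cons]
  have ho (m : ℕ) : o (m + 1) = some true :: o m := by
    simp only [o, List.replicate_succ, bits_cons]
  have h1 := forBits_runs (k := inp) (l := List.replicate k true) (t := 1 + (1 + (1 + 1)))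
    (body := fun _ => push unaryK (some true) ;; push hotI (some false) ;;
      push hotE (some false) ;; push hotJ (some false))
    (r := [none] ++ (bits (List.replicate N true) ++ ([none] ++ bits A))) (Or.inr rfl)
    (g := fun m => update (update (update (update (fun _ => []) unaryK (o m)) hotI (z m))
      hotE (z m)) hotJ (z m)) (by
      intro m b x _
      refine ((push_runs _ _ _).seq ((push_runs _ _ _).seq
        ((push_runs _ _ _).seq (push_runs _ _ _)))).congr le_rfl ?_
      funext j
      cases j <;> simp [hz, ho])
  have h3 := forBits_runs (k := inp) (l := List.replicate N true) (t := 1 + 1)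
    (body := fun _ => push unaryN (some true) ;; push unaryM (some true))
    (r := [none] ++ bits A) (Or.inr rfl)
    (g := fun m => update (update (base k 0 0 A 0 0 []) unaryN (o m)) unaryM (o m)) (by
      intro m b x _
      refine ((push_runs _ _ _).seq (push_runs _ _ _)).congr le_rfl ?_
      funext j
      cases j <;> simp [ho])
  refine ((h1.of_eq ?_).seq ((mark_runs (n := k) ?_).seq ((mark_runs (n := k) ?_).seq
    ((mark_runs (n := k) ?_).seq (h3.of_eq ?_))))).congr ?_ ?_
  · funext j
    cases j <;> simp [o, z, bits]
  any_goals simp [z]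
  · funext j
    cases j <;> simp [o, bits, base]
  · omega
  · funext j
    cases j <;> simp [o, base]

/-- The binary digits of `m`, produced by counting up. -/
def counter (m : ℕ) : List Bool := (increment true)^[m] []

theorem counter_succ (m : ℕ) : counter (m + 1) = increment true (counter m) :=
  Function.iterate_succ_apply' _ _ _

theorem length_increment_le (grow : Bool) (l : List Bool) :
    (increment grow l).length ≤ l.length + 1 := by
  induction l with
  | nil => cases grow <;> simp [increment]
  | cons b l ih => cases b <;> simp [increment, ih]

theorem length_counter_le (m : ℕ) : (counter m).length ≤ m := by
  induction m with
  | zero => simp [counter]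
  | succ m ih =>
    rw [counter_succ]
    exact (length_increment_le _ _).trans (by omega)

/-- Prepare the first two vertex identifiers. -/
def setupIds : Routine Stk :=
  each unaryK unaryK' (fun _ => each unaryN unaryN' fun _ => inc true idU tmp) ;;
  zero idU tmp ;; each idU tmp (fun _ => push idV (some false))

def setupTime (B : ℕ) : ℕ := eachTime B (eachTime B (4 * B + 3)) + (4 * B + 2 + eachTime B 1)

/-- Counting to `k * N` in binary with a growing counter produces a word of the wanted length; its
digits are then erased and the length is copied to `idV`. -/
theorem setupIds_runs {k N B : ℕ} {A : List Bool} (hk : k ≤ B) (hN : N ≤ B) (hkN : k * N ≤ B) :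
    setupIds.Runs (setupTime B) (base k N 0 A 0 0 [])
      (base k N (counter (k * N)).length A 0 0 []) := by
  have hinner (m : ℕ) (hm : m < k) (x y : List Sym) : (each unaryN unaryN'
      fun _ => inc true idU tmp).Runs (eachTime B (4 * B + 3))
      (update (update (update (base k N 0 A 0 0 []) idU (bits (counter (m * N)))) unaryK x)
        unaryK' y)
      (update (update (update (base k N 0 A 0 0 []) idU (bits (counter ((m + 1) * N)))) unaryK x)
        unaryK' y) := by
    have h1 := each_runs (k := unaryN) (T := unaryN') (by decide) (l := List.replicate N true)
      (body := fun _ => inc true idU tmp) (B := B) (t := 4 * B + 3)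
      (g := fun n => update (update (update (base k N 0 A 0 0 []) idU
        (bits (counter (m * N + n)))) unaryK x) unaryK' y) (by simpa) (by
        intro n b x' y' hn
        have hn' : n < N := by
          have := (List.getElem?_eq_some_iff.1 hn).1
          simpa using this
        refine (inc_runs (B := B) (l := counter (m * N + n)) (by decide) ?_ ?_ ?_).congr le_rfl ?_
        · refine (length_counter_le _).trans (le_trans ?_ hkN)
          nlinarith
        · simp
        · simp [base]
        · funext j
          cases j <;> simp [← add_assoc, counter_succ])
    refine (h1.of_eq ?_).congr le_rfl ?_
    · funext j
      cases j <;> simp [base]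
    · funext j
      cases j <;> simp [base, add_mul]
  have h1 := each_runs (k := unaryK) (T := unaryK') (by decide) (l := List.replicate k true)
    (body := fun _ => each unaryN unaryN' fun _ => inc true idU tmp) (B := B)
    (g := fun m => update (base k N 0 A 0 0 []) idU (bits (counter (m * N)))) (by simpa) (by
      intro m b x y hm
      refine hinner m ?_ x y
      have := (List.getElem?_eq_some_iff.1 hm).1
      simpa using this)
  refine ((h1.of_eq ?_).seq ((zero_runs (B := B) (l := counter (k * N)) (by decide) ?_ ?_
    ?_).seq ?_)).congr le_rfl rfl
  · funext j
    cases j <;> simp [base, bits, counter]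
  · exact (length_counter_le _).trans hkN
  · simp
  · simp [base]
  · have h2 := Emits.each (k := idU) (T := tmp) (out := idV) (D := []) (t := 1) (B := B)
      (c := base k N (counter (k * N)).length A 0 0 [])
      (l := List.replicate (counter (k * N)).length false)
      (body := fun _ => push idV (some false)) rfl rfl (by decide)
      (by simpa using (length_counter_le _).trans hkN) fun b => push_emits _ _ _ _
    refine (h2 _ ?_).congr le_rfl ?_
    · simp [base]
    · funext j
      cases j <;> simp [base, bits, List.flatMap_replicate]

/-- Repeat a routine for every block. -/
def forBlocks (R : Routine Stk) : Routine Stk :=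
  each hotI hotI' fun _ => each hotJ hotJ' fun _ => R

/-- Write the symbol `a` for every coordinate. -/
def fillDim (a : Sym) : Routine Stk :=
  forBlocks (each idU tmp fun _ => push out a ;; push out a ;; push out a ;; push out a)

theorem flatMap_const_replicate {α β : Type} (l : List α) (m : ℕ) (a : β) :
    (l.flatMap fun _ => List.replicate m a) = List.replicate (l.length * m) a := by
  induction l with
  | nil => simp
  | cons b l ih =>
    rw [List.flatMap_cons, ih, List.length_cons, add_mul, one_mul, add_comm, List.replicate_add]

theorem forBlocks_emits {k N L B : ℕ} {A : List Bool} (hk : k ≤ B) {R : Routine Stk} {m t : ℕ}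
    {a : Sym} {D : List Stk} (hD : (out :: hotI' :: hotI :: hotJ :: hotJ' :: D).Nodup)
    (h : R.Emits out D (base k N L A 0 0 []) (List.replicate m a) t) :
    (forBlocks R).Emits out (hotI :: hotI' :: hotJ :: hotJ' :: D) (base k N L A 0 0 [])
      (List.replicate (k * (k * m)) a) (eachTime B (eachTime B t)) := by
  have h1 := Emits.each (k := hotI) (T := hotI') (c := base k N L A 0 0 []) (l := hot k 0) (B := B)
    rfl rfl hD (by simpa [length_hot]) fun _ =>
    Emits.each (k := hotJ) (T := hotJ') (l := hot k 0) (B := B) rfl rfl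
      (by simp only [List.nodup_cons, List.mem_cons] at hD ⊢; tauto) (by simpa [length_hot])
      fun _ => h
  simp only [flatMap_const_replicate, length_hot] at h1
  exact h1

theorem fillDim_emits {k N L B : ℕ} {A : List Bool} (hk : k ≤ B) (hL : L ≤ B) (a : Sym) :
    (fillDim a).Emits out [hotI, hotI', hotJ, hotJ', idU, tmp] (base k N L A 0 0 [])
      (List.replicate (k * (k * (L * 4))) a) (eachTime B (eachTime B (eachTime B 4))) := by
  refine forBlocks_emits hk (by decide) ?_
  have h1 := Emits.each (k := idU) (T := tmp) (out := out) (D := [])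
    (c := base k N L A 0 0 []) (l := List.replicate L false) (B := B) (t := 4)
    (w := fun _ => List.replicate 4 a)
    (body := fun _ => push out a ;; push out a ;; push out a ;; push out a)
    rfl rfl (by decide) (by simpa) fun b =>
      (push_emits _ _ _ _).seq (by decide) <| (push_emits _ _ _ _).seq (by decide) <|
        (push_emits _ _ _ _).seq (by decide) (push_emits _ _ _ _)
  simp only [flatMap_const_replicate, List.length_replicate] at h1
  exact h1

/-- Write the number of sets and the dimension. -/
def emitHeader : Routine Stk :=
  forBlocks (push out (some true) ;; push out (some true)) ;; push out none ;;
  fillDim (some true) ;; push out none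

/-- Write the sets with the same first index. -/
def emitRow : Routine Stk :=
  each hotE hotE' (fun e => emitSet true e ;; emitSet false e ;; rotate hotJ tmp) ;;
  rotate hotI tmp ;; rotate hotE tmp

def emitRowTime (B : ℕ) : ℕ :=
  eachTime B (setTime B + (setTime B + (4 * B + 6))) + (4 * B + 6 + (4 * B + 6))

/-- The encodings of the two copies of the set `(i, j)`. -/
def pairWord (k N L : ℕ) (A : List Bool) (i j : ℕ) : List Sym :=
  setWord k N L A true i j ++ setWord k N L A false i j

/-- The encodings of the sets with first index `i`. -/
def rowWord (k N L : ℕ) (A : List Bool) (i : ℕ) : List Sym :=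
  (List.range k).flatMap fun j => pairWord k N L A i j

/-- The loop runs over `hotE`, a copy of `hotI`: its `m`-th bit says whether column `m` is on the
diagonal, and its length counts the columns. After `k` rotations `hotJ` is back at column 0. The
contents `x` and `y` are free for the sake of the outer loop over `unaryK`. -/
theorem emitRow_runs {k N L B : ℕ} {A : List Bool} {i : ℕ} (hi : i < k) (hA : A.length = N * N)
    (hk : k ≤ B) (hN : N ≤ B) (hL : L ≤ B) (w x y : List Sym) :
    emitRow.Runs (emitRowTime B)
      (update (update (base k N L A i 0 w) unaryK x) unaryK' y)
      (update (update (base k N L A ((i + 1) % k) 0 ((rowWord k N L A i).reverse ++ w)) unaryK x)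
        unaryK' y) := by
  have h1 := each_runs (k := hotE) (T := hotE') (by decide) (l := hot k i)
    (body := fun e => emitSet true e ;; emitSet false e ;; rotate hotJ tmp) (B := B)
    (t := setTime B + (setTime B + (4 * B + 6)))
    (g := fun m => update (update (base k N L A i (m % k)
      (((List.range m).flatMap (pairWord k N L A i)).reverse ++ w)) unaryK x) unaryK' y)
    (by simpa [length_hot]) (by
      intro m b x' y' hm
      obtain ⟨hmk, hb⟩ := List.getElem?_eq_some_iff.1 hm
      rw [length_hot] at hmk
      have hb' : b = decide (m = i) := by simpa [hot] using hb.symm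
      rw [hb', Nat.mod_eq_of_lt hmk]
      obtain ⟨l, a, hl, hl1, hl2⟩ := hot_rotate hmk
      have hset (c : Bool) := emitSet_emits c i m hA hk hN hL
      refine ((hset true _ ?_).seq ((hset false _ ?_).seq (rotate_runs (B := B) (l := l) (b := a)
        (by decide) ?_ ?_ ?_))).congr le_rfl ?_
      · simp [setStacks, base]
      · simp [setStacks, base]
      · omega
      · simpa [base] using congrArg bits hl1
      · simp [base]
      · rw [← hl2]
        funext j
        cases j <;> simp [base, flatMap_range_succ, pairWord])
  obtain ⟨l, a, hl, hl1, hl2⟩ := hot_rotate hi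
  refine ((h1.of_eq ?_).seq ((rotate_runs (B := B) (l := l) (b := a) (by decide) (by omega) ?_
    ?_).seq (rotate_runs (B := B) (l := l) (b := a) (by decide) (by omega) ?_ ?_))).congr le_rfl ?_
  · funext j
    cases j <;> simp [base]
  · simpa [base] using congrArg bits hl1
  · simp [base]
  · simpa [base] using congrArg bits hl1
  · simp [base]
  · rw [← hl2]
    funext j
    cases j <;> simp [base, rowWord, length_hot]

/-- Write all sets. -/
def emitSets : Routine Stk := each unaryK unaryK' fun _ => emitRow

theorem emitSets_runs {k N L B : ℕ} {A : List Bool} (hA : A.length = N * N)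
    (hk : k ≤ B) (hN : N ≤ B) (hL : L ≤ B) (w : List Sym) :
    emitSets.Runs (eachTime B (emitRowTime B)) (base k N L A 0 0 w)
      (base k N L A 0 0 (((List.range k).flatMap (rowWord k N L A)).reverse ++ w)) := by
  have h1 := each_runs (k := unaryK) (T := unaryK') (by decide) (l := List.replicate k true)
    (body := fun _ => emitRow) (B := B) (t := emitRowTime B)
    (g := fun m => base k N L A (m % k) 0
      (((List.range m).flatMap (rowWord k N L A)).reverse ++ w)) (by simpa) (by
      intro m b x y hm
      have hmk : m < k := by
        have := (List.getElem?_eq_some_iff.1 hm).1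
        simpa using this
      have h := emitRow_runs hmk hA hk hN hL
        (((List.range m).flatMap (rowWord k N L A)).reverse ++ w) x y
      rw [Nat.mod_eq_of_lt hmk]
      refine h.congr le_rfl ?_
      rw [flatMap_range_succ, List.reverse_append, List.append_assoc])
  refine (h1.of_eq ?_).congr le_rfl ?_
  · funext j
    cases j <;> simp [base]
  · funext j
    cases j <;> simp [base]

/-- Empty all stacks but the output. -/
def cleanup : Routine Stk :=
  clear inp ;; clear unaryK ;; clear hotI ;; clear hotE ;; clear hotJ ;; clear unaryN ;;
  clear unaryM ;; clear idU ;; clear idV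

/-- Halting with an output means that all other stacks are empty, including those of the routine.
The term `B * B` is for the matrix. -/
theorem cleanup_runs {k N L B : ℕ} {A : List Bool} (hA : A.length = N * N)
    (hk : k ≤ B) (hN : N ≤ B) (hL : L ≤ B) (w : List Sym) :
    cleanup.Runs (B * B + 8 * B + 9) (base k N L A 0 0 w) (update (fun _ => []) out w) := by
  have hNN : N * N ≤ B * B := Nat.mul_le_mul hN hN
  refine ((clear_runs rfl).seq ((clear_runs rfl).seq ((clear_runs rfl).seq ((clear_runs rfl).seq
    ((clear_runs rfl).seq ((clear_runs rfl).seq ((clear_runs rfl).seq ((clear_runs rfl).seq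
    (clear_runs rfl))))))))).congr ?_ ?_
  · simp [base, length_bits, length_hot, hA]
    omega
  · funext j
    cases j <;> simp [base]

/-- The reduction from the clique problem to the vector sum problem. -/
def reduction : Routine Stk :=
  readInput ;; setupIds ;; emitHeader ;; emitSets ;; fillDim (some false) ;; cleanup

def headerTime (B : ℕ) : ℕ :=
  eachTime B (eachTime B 2) + (1 + (eachTime B (eachTime B (eachTime B 4)) + 1))

def reductionTime (B : ℕ) : ℕ :=
  (8 * B + 8) + (setupTime B + (headerTime B + (eachTime B (emitRowTime B) +
    (eachTime B (eachTime B (eachTime B 4)) + (B * B + 8 * B + 9)))))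

/-- The output of the reduction. -/
def reductionWord (k N L : ℕ) (A : List Bool) : List Sym :=
  encodeUnary (k * (k * 2)) ++ (encodeUnary (k * (k * (L * 4))) ++
    ((List.range k).flatMap (rowWord k N L A) ++ List.replicate (k * (k * (L * 4))) (some false)))

theorem emitHeader_emits {k N L B : ℕ} {A : List Bool} (hk : k ≤ B) (hL : L ≤ B) :
    emitHeader.Emits out [hotI, hotI', hotJ, hotJ', idU, tmp] (base k N L A 0 0 [])
      (encodeUnary (k * (k * 2)) ++ encodeUnary (k * (k * (L * 4)))) (headerTime B) := by
  have h1 := forBlocks_emits (N := N) (L := L) (A := A) (D := []) (m := 2) (t := 1 + 1)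
    (a := some true) hk (by decide)
    ((push_emits out [] _ (some true)).seq (by decide) (push_emits _ _ _ (some true)))
  have h2 := Emits.seq (by decide) (h1.mono (D' := [hotI, hotI', hotJ, hotJ', idU, tmp])
    (by simp) le_rfl) (Emits.seq (by decide) (push_emits _ _ _ none) (Emits.seq (by decide)
      (fillDim_emits (N := N) (A := A) hk hL (some true)) (push_emits _ _ _ none)))
  have e : List.replicate (k * (k * 2)) (some true) ++ ([none] ++
      (List.replicate (k * (k * (L * 4))) (some true) ++ [none])) =
      encodeUnary (k * (k * 2)) ++ encodeUnary (k * (k * (L * 4))) := by simp [encodeUnary]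
  exact e ▸ h2

theorem reduction_runs {k N B : ℕ} {A : List Bool} (hA : A.length = N * N) (hk : k ≤ B) (hN : N ≤ B)
    (hkN : k * N ≤ B) :
    reduction.Runs (reductionTime B)
      (update (fun _ => []) inp (encodeUnary k ++ (encodeUnary N ++ bits A)))
      (update (fun _ => []) out (reductionWord k N (counter (k * N)).length A).reverse) := by
  have hL := (length_counter_le (k * N)).trans hkN
  have h1 := (readInput_runs (A := A) hk hN).seq ((setupIds_runs hk hN hkN).seq
    (((emitHeader_emits (N := N) (A := A) hk hL _ fun _ _ => rfl).congr le_rfl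
      (s'' := base k N (counter (k * N)).length A 0 0 (encodeUnary (k * (k * 2)) ++
        encodeUnary (k * (k * ((counter (k * N)).length * 4)))).reverse) (by
        funext j
        cases j <;> simp [base])).seq
    ((emitSets_runs hA hk hN hL _).seq
    (((fillDim_emits (N := N) (A := A) hk hL (some false) _ (by simp [base])).congr le_rfl
      (s'' := base k N (counter (k * N)).length A 0 0
        (reductionWord k N (counter (k * N)).length A).reverse) (by
        funext j
        cases j <;> simp [base, reductionWord])).seq
    (cleanup_runs hA hk hN hL _)))))
  exact h1

/-! ### Polynomial time bounds -/

/-- Bounded by a polynomial. -/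
def PolyBounded (f : ℕ → ℕ) : Prop := ∃ C a : ℕ, ∀ B, f B ≤ C * (B + 1) ^ a

theorem PolyBounded.const (c : ℕ) : PolyBounded fun _ => c := ⟨c, 0, fun _ => by simp⟩

theorem PolyBounded.id : PolyBounded fun B => B := ⟨1, 1, fun _ => by simp⟩

theorem PolyBounded.add {f g : ℕ → ℕ} (hf : PolyBounded f) (hg : PolyBounded g) :
    PolyBounded fun B => f B + g B := by
  obtain ⟨C, a, hf⟩ := hf
  obtain ⟨C', a', hg⟩ := hg
  refine ⟨C + C', a + a', fun B => ?_⟩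
  have h1 : (B + 1) ^ a ≤ (B + 1) ^ (a + a') := Nat.pow_le_pow_right (by omega) (by omega)
  have h2 : (B + 1) ^ a' ≤ (B + 1) ^ (a + a') := Nat.pow_le_pow_right (by omega) (by omega)
  rw [add_mul]
  exact Nat.add_le_add ((hf B).trans (Nat.mul_le_mul_left _ h1))
    ((hg B).trans (Nat.mul_le_mul_left _ h2))

theorem PolyBounded.mul {f g : ℕ → ℕ} (hf : PolyBounded f) (hg : PolyBounded g) :
    PolyBounded fun B => f B * g B := by
  obtain ⟨C, a, hf⟩ := hf
  obtain ⟨C', a', hg⟩ := hg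
  refine ⟨C * C', a + a', fun B => ?_⟩
  rw [pow_add, mul_mul_mul_comm]
  exact Nat.mul_le_mul (hf B) (hg B)

theorem PolyBounded.each {f : ℕ → ℕ} (hf : PolyBounded f) :
    PolyBounded fun B => eachTime B (f B) :=
  (id.mul (hf.add (const 4))).add (const 2)

theorem polyBounded_reductionTime : PolyBounded reductionTime := by
  unfold reductionTime setupTime headerTime emitRowTime setTime diagTime offTime rowTime vecTime
  repeat' first
    | exact PolyBounded.const _
    | exact PolyBounded.id
    | apply PolyBounded.each
    | apply PolyBounded.add
    | apply PolyBounded.mul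


/-! ### Binary counters and identifiers -/

theorem increment_bits (m : ℕ) : increment true m.bits = (m + 1).bits := by
  induction m using Nat.strong_induction_on with
  | _ m ih =>
    rcases Nat.even_or_odd' m with ⟨q, rfl | rfl⟩
    · rcases Nat.eq_zero_or_pos q with rfl | hq
      · simp [increment]
      · rw [Nat.bit0_bits q hq.ne', Nat.bit1_bits]; rfl
    · rw [Nat.bit1_bits, show 2 * q + 1 + 1 = 2 * (q + 1) by ring,
        Nat.bit0_bits _ (Nat.succ_ne_zero q), increment, ih q (by omega)]

theorem counter_eq_bits (m : ℕ) : counter m = m.bits := by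
  induction m with
  | zero => simp [counter]
  | succ m ih => rw [counter_succ, ih, increment_bits]

theorem length_counter (m : ℕ) : (counter m).length = m.size := by
  rw [counter_eq_bits, Nat.size_eq_bits_len]

/-- The value of a binary number. -/
def value : List Bool → ℕ
  | [] => 0
  | b :: l => b.toNat + 2 * value l

/-- The hypothesis rules out the overflow in which the last carry is dropped. -/
theorem value_increment (l : List Bool) (h : value l + 1 < 2 ^ l.length) :
    value (increment false l) = value l + 1 := by
  induction l with
  | nil => simp [value] at h
  | cons b l ih =>
    cases b
    · simp [increment, value]; omega
    · simp only [value, List.length_cons, pow_succ, Bool.toNat_true] at h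
      simp only [increment, value, Bool.toNat_false, Bool.toNat_true, ih (by omega)]
      omega

theorem value_idBits {L u : ℕ} (hu : u < 2 ^ L) : value (idBits L u) = u := by
  induction u with
  | zero =>
    have : ∀ n, value (List.replicate n false) = 0 := fun n => by
      induction n with
      | zero => rfl
      | succ n ih => simp [List.replicate_succ, value, ih]
    exact this L
  | succ u ih =>
    rw [idBits_succ, value_increment, ih (by omega)]
    rw [ih (by omega), length_idBits]
    exact hu

theorem idBits_inj {L u v : ℕ} (hu : u < 2 ^ L) (hv : v < 2 ^ L) (h : idBits L u = idBits L v) :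
    u = v := by
  rw [← value_idBits hu, ← value_idBits hv, h]

/-! ### Coordinates of the vectors -/

theorem flatMap_getElem? {α β : Type} {m : ℕ} (l : List α) (f : α → List β)
    (hf : ∀ a, (f a).length = m) (i : ℕ) {r : ℕ} (hr : r < m) :
    (l.flatMap f)[i * m + r]? = l[i]?.bind fun a => (f a)[r]? := by
  induction l generalizing i with
  | nil => simp
  | cons a l ih =>
    rw [List.flatMap_cons]
    cases i with
    | zero => rw [Nat.zero_mul, Nat.zero_add, List.getElem?_append_left (by rwa [hf])]; rfl
    | succ i =>
      rw [List.getElem?_append_right (by rw [hf, add_mul]; omega), hf,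
        show (i + 1) * m + r - m = i * m + r by rw [add_mul]; omega, ih]
      rfl

theorem length_flatMap_const {α β : Type} {m : ℕ} (l : List α) (f : α → List β)
    (hf : ∀ a, (f a).length = m) : (l.flatMap f).length = l.length * m := by
  induction l with
  | nil => simp
  | cons a l ih => simp [ih, hf, add_mul, add_comm]

theorem flatten_ofFn_mul {α : Type} {m n : ℕ} (F : Fin (m * n) → List α) :
    (List.ofFn F).flatten =
      (List.ofFn fun i => (List.ofFn fun j => F (finProdFinEquiv (i, j))).flatten).flatten := by
  rw [List.ofFn_mul, List.flatten_flatten, List.map_ofFn]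
  congr 2
  funext i
  simp only [Function.comp_apply]
  congr 2
  funext j
  congr 1
  ext
  simp [finProdFinEquiv, mul_comm, add_comm]

theorem flatten_ofFn_val {α : Type} {n : ℕ} (g : ℕ → List α) :
    (List.ofFn fun i : Fin n => g i).flatten = (List.range n).flatMap g := by
  rw [List.ofFn_eq_map, ← List.map_coe_finRange_eq_range, List.flatMap_map]
  rfl

/-- The vector with given bits. -/
def toVec (d : ℕ) (w : List Bool) : Fin d → ZMod 2 := fun t => (w[(t : ℕ)]?.getD false).toNat

theorem bool_cast_eq_one (b : Bool) [Decidable (((b.toNat : ℕ) : ZMod 2) = 1)] :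
    decide (((b.toNat : ℕ) : ZMod 2) = 1) = b := by
  cases b <;> simp

theorem encodeVec_toVec {d : ℕ} {w : List Bool} (hw : w.length = d) :
    encodeVec (toVec d w) = bits w := by
  subst hw
  simp only [encodeVec, toVec, bits]
  refine List.ext_getElem (by simp) fun i h1 h2 => ?_
  simp [bool_cast_eq_one]

theorem encodeVec_zero (d : ℕ) : encodeVec (0 : Fin d → ZMod 2) = List.replicate d (some false) := by
  refine List.eq_replicate_iff.2 ⟨by simp [encodeVec], fun a ha => ?_⟩
  have h : ¬d = 0 ∧ a = some false := by simpa [encodeVec, eq_comm] using ha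
  exact h.2

theorem toVec_injOn {d : ℕ} {w w' : List Bool} (hw : w.length = d) (hw' : w'.length = d)
    (h : toVec d w = toVec d w') : w = w' := by
  have h1 : bits w = bits w' := by rw [← encodeVec_toVec hw, h, encodeVec_toVec hw']
  exact List.map_injective_iff.2 (Option.some_injective _) h1

theorem length_mask (m : Bool) (p : List Bool) : (mask m p).length = p.length := by simp [mask]

theorem mask_getElem? (m : Bool) (p : List Bool) (l : ℕ) :
    (mask m p)[l]?.getD false = (m && p[l]?.getD false) := by
  cases h : p[l]? <;> simp [mask, h]

theorem length_vecBlock {L : ℕ} {p q : List Bool} (hp : p.length = L) (hq : q.length = L)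
    (c e h h' : Bool) : (vecBlock c e h h' p q).length = L * 4 := by
  simp only [vecBlock, List.length_append, length_mask, hp, hq]
  ring

theorem vecBlock_getElem? {L : ℕ} {p q : List Bool} (hp : p.length = L) (hq : q.length = L)
    (c e h h' : Bool) {l : ℕ} (hl : l < L) :
    (vecBlock c e h h' p q)[l]?.getD false = (c && (h && xor h' e) && p[l]?.getD false) ∧
    (vecBlock c e h h' p q)[L + l]?.getD false = (c && (h' && xor h e) && q[l]?.getD false) ∧
    (vecBlock c e h h' p q)[2 * L + l]?.getD false = (h && h' && p[l]?.getD false) ∧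
    (vecBlock c e h h' p q)[3 * L + l]?.getD false = (h && h' && q[l]?.getD false) := by
  refine ⟨?_, ?_, ?_, ?_⟩
  · rw [vecBlock, List.getElem?_append_left (by simpa [length_mask, hp]), mask_getElem?]
  · rw [vecBlock, List.getElem?_append_right (by simp [length_mask, hp]), length_mask, hp,
      List.getElem?_append_left (by simpa [length_mask, hq]), mask_getElem?, Nat.add_sub_cancel_left]
  · rw [vecBlock, List.getElem?_append_right (by simp [length_mask, hp]; omega), length_mask, hp,
      List.getElem?_append_right (by simp [length_mask, hq]; omega), length_mask, hq,
      List.getElem?_append_left (by simp [length_mask, hp]; omega), mask_getElem?,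
      show 2 * L + l - L - L = l by omega]
  · rw [vecBlock, List.getElem?_append_right (by simp [length_mask, hp]; omega), length_mask, hp,
      List.getElem?_append_right (by simp [length_mask, hq]; omega), length_mask, hq,
      List.getElem?_append_right (by simp [length_mask, hp]; omega), length_mask, hp, mask_getElem?,
      show 3 * L + l - L - L - L = l by omega]

theorem hot_getElem? {k a : ℕ} (i : ℕ) (ha : a < k) : (hot k i)[a]? = some (decide (a = i)) := by
  simp [hot, ha]

section vectors

variable {k L : ℕ}

theorem length_vecBits {p q : List Bool} (hp : p.length = L) (hq : q.length = L) (c e : Bool)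
    (i j : ℕ) : (vecBits c e (hot k i) (hot k j) p q).length = k * (k * (L * 4)) := by
  rw [vecBits, length_flatMap_const (m := k * (L * 4)), length_hot]
  intro h
  rw [length_flatMap_const _ _ fun h' => length_vecBlock hp hq c e h h', length_hot]

theorem vecBits_getElem? {p q : List Bool} (hp : p.length = L) (hq : q.length = L) (c e : Bool)
    (i j : ℕ) {a b r : ℕ} (ha : a < k) (hb : b < k) (hr : r < L * 4) :
    (vecBits c e (hot k i) (hot k j) p q)[a * (k * (L * 4)) + (b * (L * 4) + r)]? =
      (vecBlock c e (decide (a = i)) (decide (b = j)) p q)[r]? := by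
  have hr' : b * (L * 4) + r < k * (L * 4) := by
    calc b * (L * 4) + r < b * (L * 4) + L * 4 := by omega
      _ = (b + 1) * (L * 4) := by ring
      _ ≤ _ := Nat.mul_le_mul_right _ hb
  rw [vecBits, flatMap_getElem? (m := k * (L * 4)) _ _ _ _ hr', hot_getElem? _ ha,
    Option.bind_some, flatMap_getElem? (m := L * 4) _ _ _ _ hr, hot_getElem? _ hb,
    Option.bind_some]
  · exact fun h' => length_vecBlock hp hq c e _ h'
  · intro h
    rw [length_flatMap_const _ _ fun h' => length_vecBlock hp hq c e h h', length_hot]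

/-- The vector of the pair `(u, v)` in the copy `c` of the set `(i, j)`. -/
def pairVec (k L : ℕ) (c : Bool) (i j : ℕ) (p : ℕ × ℕ) : Fin (k * (k * (L * 4))) → ZMod 2 :=
  toVec _ (vecBits c (decide (i = j)) (hot k i) (hot k j) (idBits L p.1) (idBits L p.2))

/-- A bit of an identifier, as a number. -/
def idBit (L u l : ℕ) : ZMod 2 := ((idBits L u)[l]?.getD false).toNat

theorem idBits_eq_of_idBit {u v : ℕ} (h : ∀ l < L, idBit L u l = idBit L v l) :
    idBits L u = idBits L v := by
  refine toVec_injOn (length_idBits L u) (length_idBits L v) ?_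
  funext l
  exact h l l.2

/-- The third and fourth quarters of block `(i, j)` contain both identifiers, whatever the copy and
whether or not the set is diagonal. -/
theorem pairVec_injOn {c : Bool} {i j : ℕ} (hi : i < k) (hj : j < k) {p q : ℕ × ℕ}
    (hp : p.1 < 2 ^ L ∧ p.2 < 2 ^ L) (hq : q.1 < 2 ^ L ∧ q.2 < 2 ^ L)
    (h : pairVec k L c i j p = pairVec k L c i j q) : p = q := by
  have h1 := toVec_injOn (length_vecBits (length_idBits L _) (length_idBits L _) _ _ _ _)
    (length_vecBits (length_idBits L _) (length_idBits L _) _ _ _ _) h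
  have h2 (r : ℕ) (hr : r < L * 4) := congrArg
    (fun w : List Bool => w[i * (k * (L * 4)) + (j * (L * 4) + r)]?.getD false) h1
  have h3 (l : ℕ) (hl : l < L) :=
    vecBlock_getElem? (length_idBits L p.1) (length_idBits L p.2) c (decide (i = j)) true true hl
  have h4 (l : ℕ) (hl : l < L) :=
    vecBlock_getElem? (length_idBits L q.1) (length_idBits L q.2) c (decide (i = j)) true true hl
  refine Prod.ext (idBits_inj hp.1 hq.1 (idBits_eq_of_idBit (L := L) fun l hl => ?_))
    (idBits_inj hp.2 hq.2 (idBits_eq_of_idBit (L := L) fun l hl => ?_))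
  · have h5 := h2 (2 * L + l) (by omega)
    simp only [vecBits_getElem? (length_idBits L _) (length_idBits L _) _ _ _ _ hi hj
      (show 2 * L + l < L * 4 by omega), decide_true, (h3 l hl).2.2.1, (h4 l hl).2.2.1,
      Bool.true_and] at h5
    rw [idBit, h5, idBit]
  · have h5 := h2 (3 * L + l) (by omega)
    simp only [vecBits_getElem? (length_idBits L _) (length_idBits L _) _ _ _ _ hi hj
      (show 3 * L + l < L * 4 by omega), decide_true, (h3 l hl).2.2.2, (h4 l hl).2.2.2,
      Bool.true_and] at h5
    rw [idBit, h5, idBit]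

/-- Mixed radix expansion of a coordinate into row and column of the block, quarter `s` and bit `l`.
-/
theorem forall_coordinate {k L : ℕ} {P : Fin (k * (k * (L * 4))) → Prop} :
    (∀ t, P t) ↔ ∀ (a b : Fin k) (s : Fin 4) (l : Fin L),
      ∀ h : a * (k * (L * 4)) + (b * (L * 4) + (s * L + l)) < k * (k * (L * 4)), P ⟨_, h⟩ := by
  refine ⟨fun h _ _ _ _ _ => h _, fun h t => ?_⟩
  obtain ⟨⟨a, t1⟩, rfl⟩ := finProdFinEquiv.surjective t
  obtain ⟨⟨b, t2⟩, rfl⟩ := finProdFinEquiv.surjective t1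
  obtain ⟨⟨s, l⟩, hsl⟩ := finProdFinEquiv.surjective (Fin.cast (mul_comm L 4) t2)
  have hv : (t2 : ℕ) = s * L + l := by
    have := congrArg Fin.val hsl
    simp [finProdFinEquiv] at this
    rw [← this]; ring
  have e : ((finProdFinEquiv (a, finProdFinEquiv (b, t2)) : Fin (k * (k * (L * 4)))) : ℕ) =
      a * (k * (L * 4)) + (b * (L * 4) + (s * L + l)) := by
    simp [finProdFinEquiv, hv]; ring
  have h' := h a b s l (e ▸ Fin.is_lt _)
  convert h'

end vectors


/-! ### The sets and the vanishing of a sum -/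

/-- The pairs of vertices that have a vector in the set `(i, j)`. -/
def vertexPairs (N : ℕ) (A : List Bool) (i j : ℕ) : List (ℕ × ℕ) :=
  if i = j then (List.range N).map fun u => (u, u)
  else (List.range N ×ˢ List.range N).filter fun p => A[p.1 * N + p.2]? = some true

theorem mem_vertexPairs {N : ℕ} {A : List Bool} {i j : ℕ} {p : ℕ × ℕ} :
    p ∈ vertexPairs N A i j ↔ p.1 < N ∧ p.2 < N ∧
      if i = j then p.1 = p.2 else A[p.1 * N + p.2]? = some true := by
  obtain ⟨u, v⟩ := p
  by_cases h : i = j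
  · simp only [vertexPairs, h, if_true, List.mem_map, List.mem_range, Prod.mk.injEq]
    constructor
    · rintro ⟨a, ha, rfl, rfl⟩
      exact ⟨ha, ha, rfl⟩
    · rintro ⟨hu, -, rfl⟩
      exact ⟨u, hu, rfl, rfl⟩
  · simp [vertexPairs, h, and_assoc]

theorem nodup_vertexPairs (N : ℕ) (A : List Bool) (i j : ℕ) : (vertexPairs N A i j).Nodup := by
  unfold vertexPairs
  split_ifs
  · exact List.nodup_range.map fun a b h => (Prod.mk.inj h).1
  · exact (List.nodup_range.product List.nodup_range).filter _

theorem length_vertexPairs_self (N : ℕ) (A : List Bool) (i : ℕ) :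
    (vertexPairs N A i i).length = N := by
  simp [vertexPairs]

theorem length_vertexPairs_le (N : ℕ) (A : List Bool) (i j : ℕ) :
    (vertexPairs N A i j).length ≤ N * N := by
  unfold vertexPairs
  split_ifs
  · simpa using Nat.le_mul_self N
  · exact (List.length_filter_le _ _).trans (by simp [List.length_product])

theorem flatMap_filter_eq {α β : Type} (l : List α) (p : α → Bool) (f : α → List β) :
    (l.filter p).flatMap f = l.flatMap fun a => if p a then f a else [] := by
  induction l with
  | nil => rfl
  | cons a l ih => by_cases h : p a <;> simp [h, ih]

theorem setWord_eq (k N L : ℕ) (A : List Bool) (c : Bool) (i j : ℕ) :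
    setWord k N L A c i j = encodeGroup ((vertexPairs N A i j).map (pairVec k L c i j)) := by
  have henc (p : ℕ × ℕ) : encodeVec (pairVec k L c i j p) =
      bits (vecBits c (decide (i = j)) (hot k i) (hot k j) (idBits L p.1) (idBits L p.2)) :=
    encodeVec_toVec (length_vecBits (length_idBits L _) (length_idBits L _) _ _ _ _)
  rw [setWord, encodeGroup, List.flatMap_map]
  congr 1
  simp only [henc]
  by_cases h : i = j
  · simp [h, vertexPairs, diagWord, List.flatMap_map]
  · simp only [h, if_false, vertexPairs, flatMap_filter_eq, offWord, decide_eq_true_eq, decide_false]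
    change _ = List.flatMap _ (List.product _ _)
    rw [List.product, List.flatMap_assoc]
    simp only [List.flatMap_map]

/-- The indices of the sets. -/
def setIndex (k : ℕ) : Fin (k * (k * 2)) ≃ Fin k × Fin k × Fin 2 :=
  finProdFinEquiv.symm.trans ((Equiv.refl _).prodCongr finProdFinEquiv.symm)

theorem toNat_and (b c : Bool) : (((b && c).toNat : ℕ) : ZMod 2) = b.toNat * c.toNat := by
  cases b <;> cases c <;> simp

theorem toNat_xor (b c : Bool) : (((xor b c).toNat : ℕ) : ZMod 2) = b.toNat + c.toNat := by
  revert b c; decide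

theorem toNat_decide {k : ℕ} (a b : Fin k) :
    (((decide ((a : ℕ) = b)).toNat : ℕ) : ZMod 2) = if a = b then 1 else 0 := by
  by_cases h : a = b
  · simp [h]
  · simp [h, Fin.val_inj]

/-- When the vectors of a choice of pairs sum up to zero. -/
theorem sum_pairVec_eq_zero_iff {k L : ℕ} (f : Fin k × Fin k × Fin 2 → ℕ × ℕ) :
    ∑ x, pairVec k L (decide (x.2.2 = 0)) x.1 x.2.1 (f x) = 0 ↔
      ∀ (a b : Fin k) (l : Fin L),
        idBit L (f (a, b, 0)).1 l + idBit L (f (a, a, 0)).1 l = 0 ∧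
        idBit L (f (a, b, 0)).2 l + idBit L (f (b, b, 0)).2 l = 0 ∧
        idBit L (f (a, b, 0)).1 l + idBit L (f (a, b, 1)).1 l = 0 ∧
        idBit L (f (a, b, 0)).2 l + idBit L (f (a, b, 1)).2 l = 0 := by
  rw [funext_iff, forall_coordinate]
  refine forall_congr' fun a => forall_congr' fun b => ?_
  rw [forall_comm]
  refine forall_congr' fun l => ?_
  have hlt (s : Fin 4) : (s : ℕ) * L + l < L * 4 := by
    have := s.2
    have := l.2
    nlinarith
  have hlt' (s : Fin 4) : (a : ℕ) * (k * (L * 4)) + (b * (L * 4) + (s * L + l)) <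
      k * (k * (L * 4)) := by
    have h1 := hlt s
    have h2 : ((b : ℕ) + 1) * (L * 4) ≤ k * (L * 4) := Nat.mul_le_mul_right _ b.2
    have h3 : ((a : ℕ) + 1) * (k * (L * 4)) ≤ k * (k * (L * 4)) := Nat.mul_le_mul_right _ a.2
    rw [add_mul, one_mul] at h2 h3
    omega
  have hcoord (s : Fin 4) : (∀ h : (a : ℕ) * (k * (L * 4)) + (b * (L * 4) + (s * L + l)) <
        k * (k * (L * 4)),
      (∑ x, pairVec k L (decide (x.2.2 = 0)) x.1 x.2.1 (f x)) ⟨_, h⟩ =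
        (0 : Fin (k * (k * (L * 4))) → ZMod 2) ⟨_, h⟩) ↔
      ∑ x : Fin k × Fin k × Fin 2, ((((vecBlock (decide (x.2.2 = 0)) (decide ((x.1 : ℕ) = x.2.1))
        (decide ((a : ℕ) = x.1)) (decide ((b : ℕ) = x.2.1)) (idBits L (f x).1)
        (idBits L (f x).2))[(s : ℕ) * L + l]?.getD false).toNat : ℕ) : ZMod 2) = 0 := by
    rw [forall_prop_of_true (hlt' s), Finset.sum_apply]
    simp only [pairVec, toVec, Pi.zero_apply, vecBits_getElem? (length_idBits L _)
      (length_idBits L _) _ _ _ _ a.2 b.2 (hlt s)]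
  rw [forall_congr' hcoord]
  have hblock (x : Fin k × Fin k × Fin 2) := vecBlock_getElem? (length_idBits L (f x).1)
    (length_idBits L (f x).2) (decide (x.2.2 = 0)) (decide ((x.1 : ℕ) = x.2.1))
    (decide ((a : ℕ) = x.1)) (decide ((b : ℕ) = x.2.1)) l.2
  have h0 (x : Fin k × Fin k × Fin 2) := (hblock x).1
  have h1 (x : Fin k × Fin k × Fin 2) := (hblock x).2.1
  have h2 (x : Fin k × Fin k × Fin 2) := (hblock x).2.2.1
  have h3 (x : Fin k × Fin k × Fin 2) := (hblock x).2.2.2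
  simp only [Fin.forall_fin_succ, IsEmpty.forall_iff, and_true]
  simp only [Fin.val_zero, Fin.val_succ, zero_mul, zero_add, one_mul, Nat.reduceAdd, h0, h1, h2, h3]
  -- Over 𝔽₂ the exclusive or in a mask is a sum: one summand is the indicator of the set `(a, b)`,
  -- the other that of `(a, a)` or `(b, b)`. Each indicator sum collapses to one term. For `a = b`
  -- the first two conditions read x + x = 0 and are void.
  simp only [toNat_and, toNat_xor, toNat_decide, Fintype.sum_prod_type, Fin.sum_univ_two]
  simp only [idBit]
  simp [add_mul, mul_add, Finset.sum_add_distrib]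


/-! ### The constructed instance and its correctness -/

open Classical in
/-- The adjacency matrix, row by row. -/
noncomputable def adjBits (x : CliqueInstance) : List Bool :=
  (List.finRange x.n).flatMap fun u => List.ofFn fun v => decide (x.G.Adj u v)

theorem length_adjBits (x : CliqueInstance) : (adjBits x).length = x.n * x.n := by
  rw [adjBits, length_flatMap_const _ _ fun u => List.length_ofFn, List.length_finRange]

theorem adjBits_getElem? (x : CliqueInstance) (u v : Fin x.n) :
    (adjBits x)[(u : ℕ) * x.n + v]? = some true ↔ x.G.Adj u v := by
  rw [adjBits, flatMap_getElem? _ _ (fun u => List.length_ofFn) _ v.2]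
  simp

theorem clique_encode_eq (x : CliqueInstance) :
    x.encode = encodeUnary x.k ++ (encodeUnary x.n ++ bits (adjBits x)) := by
  rw [CliqueInstance.encode, adjBits, List.ofFn_eq_map, bits, List.map_flatMap]
  simp only [List.map_ofFn]
  rfl

/-- The length of the identifiers. -/
def idLength (k N : ℕ) : ℕ := (counter (k * N)).length

/-- An index below `k` ensures `k ≥ 1`, so that N ≤ kN. -/
theorem lt_two_pow_idLength {k N i u : ℕ} (hi : i < k) (hu : u < N) : u < 2 ^ idLength k N := by
  rw [idLength, length_counter]
  refine lt_of_lt_of_le ?_ (Nat.lt_size_self (k * N)).le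
  nlinarith

/-- The instance of the vector sum problem that the reduction constructs. -/
noncomputable def sumInstance (x : CliqueInstance) : VectorSumInstance where
  k := x.k * (x.k * 2)
  d := x.k * (x.k * (idLength x.k x.n * 4))
  V t := (vertexPairs x.n (adjBits x) (setIndex x.k t).1 (setIndex x.k t).2.1).map
    (pairVec x.k (idLength x.k x.n) (decide ((setIndex x.k t).2.2 = 0)) (setIndex x.k t).1
      (setIndex x.k t).2.1)
  nodup t := by
    refine List.Nodup.map_on ?_ (nodup_vertexPairs _ _ _ _)
    intro p hp q hq h
    rw [mem_vertexPairs] at hp hq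
    have hi := (setIndex x.k t).1.2
    exact pairVec_injOn hi (setIndex x.k t).2.1.2
      ⟨lt_two_pow_idLength hi hp.1, lt_two_pow_idLength hi hp.2.1⟩
      ⟨lt_two_pow_idLength hi hq.1, lt_two_pow_idLength hi hq.2.1⟩ h
  t := 0

theorem encode_sumInstance (x : CliqueInstance) :
    (sumInstance x).encode = reductionWord x.k x.n (idLength x.k x.n) (adjBits x) := by
  rw [VectorSumInstance.encode, reductionWord]
  congr 2
  refine congrArg₂ _ ?_ (encodeVec_zero _)
  simp only [sumInstance, ← setWord_eq]
  refine (flatten_ofFn_mul _).trans ?_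
  rw [← flatten_ofFn_val (n := x.k) (rowWord _ _ _ _)]
  congr 2
  funext i
  rw [flatten_ofFn_mul, rowWord, ← flatten_ofFn_val (n := x.k) (pairWord _ _ _ _ _)]
  congr 2
  funext j
  simp [setIndex, pairWord]

/-- From a solution, the diagonal choices form the clique and the off-diagonal choices certify its
edges. Conversely, an enumeration of a clique determines all choices, and every condition becomes x
+ x = 0. -/
theorem sumInstance_yes_iff (x : CliqueInstance) :
    kVectorSum.Yes (sumInstance x) ↔ kClique.Yes x := by
  constructor
  · rintro ⟨v, hv, hsum⟩
    change ∀ t, v t ∈ List.map _ _ at hv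
    choose p hp hpv using fun t => List.mem_map.1 (hv t)
    let f (y : Fin x.k × Fin x.k × Fin 2) : ℕ × ℕ := p ((setIndex x.k).symm y)
    have hf (y : Fin x.k × Fin x.k × Fin 2) : f y ∈ vertexPairs x.n (adjBits x) y.1 y.2.1 := by
      have := hp ((setIndex x.k).symm y)
      rwa [Equiv.apply_symm_apply] at this
    have hzero : ∑ y, pairVec x.k (idLength x.k x.n) (decide (y.2.2 = 0)) y.1 y.2.1 (f y) = 0 := by
      refine Eq.trans ?_ hsum
      refine Fintype.sum_equiv (setIndex x.k).symm _ _ fun y => ?_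
      have := hpv ((setIndex x.k).symm y)
      rwa [Equiv.apply_symm_apply] at this
    rw [sum_pairVec_eq_zero_iff] at hzero
    simp only [mem_vertexPairs] at hf
    have heq {i : Fin x.k} {u v : ℕ} (hu : u < x.n) (hv : v < x.n) (h : ∀ l : Fin (idLength x.k x.n),
        idBit (idLength x.k x.n) u l + idBit (idLength x.k x.n) v l = 0) : u = v :=
      idBits_inj (lt_two_pow_idLength i.2 hu) (lt_two_pow_idLength i.2 hv)
        (idBits_eq_of_idBit fun l hl => CharTwo.add_eq_zero.1 (h ⟨l, hl⟩))
    let z (a : Fin x.k) : Fin x.n := ⟨(f (a, a, 0)).1, (hf _).1⟩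
    have hadj {a b : Fin x.k} (hab : a ≠ b) : x.G.Adj (z a) (z b) := by
      rw [← adjBits_getElem?]
      have h1 : (f (a, b, 0)).1 = z a :=
        heq (i := a) (hf _).1 (hf _).1 fun l => (hzero a b l).1
      have h2 : (f (a, b, 0)).2 = (f (b, b, 0)).2 :=
        heq (i := a) (hf _).2.1 (hf _).2.1 fun l => (hzero a b l).2.1
      have h3 : (f (b, b, 0)).1 = (f (b, b, 0)).2 := by simpa using (hf (b, b, 0)).2.2
      have h4 := (hf (a, b, 0)).2.2
      rw [if_neg (fun h => hab (Fin.ext h)), h1, h2, ← h3] at h4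
      exact h4
    -- Adjacency is irreflexive, so the edge conditions already force distinct vertices.
    have hinj : Function.Injective z := fun a b h => by
      by_contra hab
      exact (hadj hab).ne h
    refine ⟨Finset.univ.map ⟨z, hinj⟩, ?_, by simp⟩
    intro u hu v hv huv
    simp only [Finset.coe_map, Function.Embedding.coeFn_mk, Finset.coe_univ, Set.image_univ,
      Set.mem_range] at hu hv
    obtain ⟨a, rfl⟩ := hu
    obtain ⟨b, rfl⟩ := hv
    exact hadj fun h => huv (congrArg z h)
  · rintro ⟨s, hs⟩
    let z (a : Fin x.k) : Fin x.n := s.orderEmbOfFin hs.card_eq a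
    have hz (a : Fin x.k) : z a ∈ s := s.orderEmbOfFin_mem hs.card_eq a
    have hadj {a b : Fin x.k} (hab : a ≠ b) : x.G.Adj (z a) (z b) :=
      hs.isClique (hz a) (hz b) fun h => hab ((s.orderEmbOfFin hs.card_eq).injective h)
    let f (y : Fin x.k × Fin x.k × Fin 2) : ℕ × ℕ := (z y.1, z y.2.1)
    have hzero : ∑ y, pairVec x.k (idLength x.k x.n) (decide (y.2.2 = 0)) y.1 y.2.1 (f y) = 0 := by
      rw [sum_pairVec_eq_zero_iff]
      exact fun a b l => ⟨CharTwo.add_self_eq_zero _, CharTwo.add_self_eq_zero _,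
        CharTwo.add_self_eq_zero _, CharTwo.add_self_eq_zero _⟩
    refine ⟨fun t => pairVec x.k (idLength x.k x.n) (decide ((setIndex x.k t).2.2 = 0))
      (setIndex x.k t).1 (setIndex x.k t).2.1 (f (setIndex x.k t)), fun t => ?_, ?_⟩
    · refine List.mem_map_of_mem ?_
      rw [mem_vertexPairs]
      refine ⟨(z _).2, (z _).2, ?_⟩
      split_ifs with h
      · simp only [f, Fin.ext h]
      · exact (adjBits_getElem? x _ _).2 (hadj fun h' => h (congrArg Fin.val h'))
    · refine Eq.trans ?_ hzero
      exact Fintype.sum_equiv (setIndex x.k) _ _ fun t => rfl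

/-! ### Number of vectors and dimension -/

theorem sumInstance_n (x : CliqueInstance) : (sumInstance x).n =
    ∑ y : Fin x.k × Fin x.k × Fin 2, (vertexPairs x.n (adjBits x) y.1 y.2.1).length := by
  refine Fintype.sum_equiv (setIndex x.k) _ _ fun t => ?_
  exact List.length_map _

/-- The two copies of the `k` diagonal sets suffice, so the bound does not depend on the edges. -/
theorem le_sumInstance_n (x : CliqueInstance) : 2 * (x.k * x.n) ≤ (sumInstance x).n := by
  rw [sumInstance_n, Fintype.sum_prod_type]
  have h (i : Fin x.k) : 2 * x.n ≤ ∑ y : Fin x.k × Fin 2,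
      (vertexPairs x.n (adjBits x) i y.1).length := by
    rw [Fintype.sum_prod_type]
    refine le_trans ?_ (Finset.single_le_sum (fun _ _ => Nat.zero_le _) (Finset.mem_univ i))
    simp [length_vertexPairs_self, two_mul]
  refine le_trans ?_ (Finset.sum_le_sum fun i _ => h i)
  simp
  exact le_of_eq (by ring)

theorem sumInstance_n_le (x : CliqueInstance) : (sumInstance x).n ≤ 2 * (x.k * x.n) ^ 2 := by
  rw [sumInstance_n]
  refine (Finset.sum_le_sum fun y _ => length_vertexPairs_le x.n (adjBits x) y.1 y.2.1).trans ?_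
  simp
  exact le_of_eq (by ring)

/-- The dimension of the constructed instance is of the order `k log n`. -/
theorem sumInstance_dim (x : CliqueInstance) :
    2 / (3 * Real.log 2) * (((sumInstance x).k : ℝ) * Real.log ((sumInstance x).n : ℝ)) ≤
        ((sumInstance x).d : ℝ) ∧
      ((sumInstance x).d : ℝ) ≤
        2 / Real.log 2 * (((sumInstance x).k : ℝ) * Real.log ((sumInstance x).n : ℝ)) := by
  have hlog : 0 < Real.log 2 := Real.log_pos one_lt_two
  have key : Real.log (sumInstance x).n ≤ 3 * (idLength x.k x.n * Real.log 2) ∧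
      idLength x.k x.n * Real.log 2 ≤ Real.log (sumInstance x).n := by
    have h1 := le_sumInstance_n x
    have h2 := sumInstance_n_le x
    -- In the degenerate case there are no vectors and L = 0; both bounds hold because `Real.log 0 =
    -- 0`.
    rcases Nat.eq_zero_or_pos (x.k * x.n) with h0 | hpos
    · have hn : (sumInstance x).n = 0 := by
        rw [h0] at h2; simpa using h2
      have hL : idLength x.k x.n = 0 := by rw [idLength, length_counter, h0, Nat.size_zero]
      simp [hn, hL]
    · have hlt : x.k * x.n < 2 ^ idLength x.k x.n := by
        rw [idLength, length_counter]; exact Nat.lt_size_self _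
      have hL : 0 < idLength x.k x.n := by
        rw [idLength, length_counter]; exact Nat.size_pos.2 hpos
      -- A number of binary length L is at least 2^(L-1).
      have hle : 2 ^ (idLength x.k x.n) ≤ 2 * (x.k * x.n) := by
        obtain ⟨m, hm⟩ := Nat.exists_eq_succ_of_ne_zero hL.ne'
        rw [hm, pow_succ, mul_comm]
        refine Nat.mul_le_mul_left _ (Nat.lt_size.1 ?_)
        rw [← length_counter, ← idLength, hm]
        exact Nat.lt_succ_self m
      have hn : 0 < (sumInstance x).n := by omega
      constructor
      · have h3 : (sumInstance x).n ≤ 2 ^ (3 * idLength x.k x.n) := by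
          have h4 : 2 ≤ 2 ^ idLength x.k x.n := Nat.le_self_pow hL.ne' 2
          calc (sumInstance x).n ≤ 2 * (x.k * x.n) ^ 2 := h2
            _ ≤ 2 ^ idLength x.k x.n * (2 ^ idLength x.k x.n) ^ 2 := by gcongr
            _ = 2 ^ (3 * idLength x.k x.n) := by rw [← pow_succ', ← pow_mul, mul_comm]
        have h5 : Real.log (sumInstance x).n ≤ Real.log ((2 : ℝ) ^ (3 * idLength x.k x.n)) :=
          Real.log_le_log (by exact_mod_cast hn) (by exact_mod_cast h3)
        rw [Real.log_pow] at h5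
        push_cast at h5
        linarith
      · rw [← Real.log_pow]
        exact Real.log_le_log (by positivity) (by exact_mod_cast hle.trans h1)
  have hd : ((sumInstance x).d : ℝ) = (x.k : ℝ) * (x.k * (idLength x.k x.n * 4)) := by
    simp [sumInstance]
  have hk : ((sumInstance x).k : ℝ) = (x.k : ℝ) * (x.k * 2) := by
    simp [sumInstance]
  have hkk : (0 : ℝ) ≤ (x.k : ℝ) * x.k := by positivity
  rw [hd, hk]
  constructor
  · rw [div_mul_eq_mul_div, div_le_iff₀ (by positivity)]
    nlinarith [mul_le_mul_of_nonneg_left key.1 hkk]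
  · rw [div_mul_eq_mul_div, le_div_iff₀ hlog]
    nlinarith [mul_le_mul_of_nonneg_left key.2 hkk]

/-! ### Cost of the reduction and conclusion -/

theorem reduction_runs_encode (x : CliqueInstance) {B : ℕ} (hk : x.k ≤ B) (hN : x.n ≤ B)
    (hkN : x.k * x.n ≤ B) :
    reduction.Runs (reductionTime B) (Function.update (fun _ => []) Stk.inp x.encode)
      (Function.update (fun _ => []) Stk.out (sumInstance x).encode.reverse) := by
  rw [clique_encode_eq, encode_sumInstance]
  exact reduction_runs (length_adjBits x) hk hN hkN

/-- The encoding of the constructed instance is produced within polynomial time, so that its length is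
polynomial. -/
theorem exists_reduction_bound : ∃ C a : ℕ, ∀ x : CliqueInstance,
    reduction.Runs (C * (x.encode.length + 1) ^ a)
      (Function.update (fun _ => []) Stk.inp x.encode)
      (Function.update (fun _ => []) Stk.out (sumInstance x).encode.reverse) ∧
    (sumInstance x).encode.length ≤ C * (x.encode.length + 1) ^ a := by
  obtain ⟨C, a, hC⟩ := polyBounded_reductionTime
  refine ⟨C, 2 * a, fun x => ?_⟩
  have hlen : x.k + x.n ≤ x.encode.length := by
    simp [clique_encode_eq, encodeUnary]; omega
  set n := x.encode.length
  -- The value n² + n dominates `x.k`, `x.n` and their product, and its successor is at most (n +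
  -- 1)², whence the doubled exponent.
  have hB : reductionTime (n * n + n) ≤ C * (n + 1) ^ (2 * a) := by
    refine (hC _).trans ?_
    rw [pow_mul]
    gcongr
    nlinarith
  have hkN : x.k * x.n ≤ n * n := Nat.mul_le_mul (by omega) (by omega)
  have h := (reduction_runs_encode x (B := n * n + n) (by omega) (by omega) (by omega)).mono hB
  refine ⟨h, ?_⟩
  simpa using h.length_le Stk.out

end StackMachine

open StackMachine in
theorem mainTheorem2 (hW : W1NeFPT) :
    ∃ c₁ c₂ : ℝ, 0 < c₁ ∧ 0 < c₂ ∧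
      ¬ (kVectorSum.restrict fun x : VectorSumInstance =>
          c₁ * ((x.k : ℝ) * Real.log (x.n : ℝ)) ≤ (x.d : ℝ) ∧
          (x.d : ℝ) ≤ c₂ * ((x.k : ℝ) * Real.log (x.n : ℝ))).FPT := by
  classical
  have hlog : 0 < Real.log 2 := Real.log_pos one_lt_two
  refine ⟨2 / (3 * Real.log 2), 2 / Real.log 2, by positivity, by positivity, ?_⟩
  rintro ⟨f, hf, c, M, hM⟩
  obtain ⟨C, a, hCa⟩ := exists_reduction_bound
  -- The summand 2C + 1 pays for the reduction (C) and the transfer of its output (C + 1). The other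
  -- summand is the solver's time at parameter 2k² on an input of length plus one at most (C +
  -- 1)(|x| + 1)^a.
  refine hW ⟨fun k => (2 * C + 1) + f (k * (k * 2)) * (C + 1) ^ c, ?_, a + a * c,
    precompose reduction Stk.inp Stk.out M, fun x => ?_⟩
  · have h1 : Primrec fun k : ℕ => k * (k * 2) :=
      Primrec.nat_mul.comp .id (Primrec.nat_mul.comp .id (.const 2))
    have h2 : Primrec fun m : ℕ => (2 * C + 1) + m * (C + 1) ^ c :=
      Primrec.nat_add.comp (.const _) (Primrec.nat_mul.comp .id (.const _))
    exact h2.to_comp.comp (hf.comp h1.to_comp)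
  · obtain ⟨hrun, hlen⟩ := hCa x
    have hM' := hM ⟨sumInstance x, sumInstance_dim x⟩
    have hb : decide ((kVectorSum.restrict fun x : VectorSumInstance =>
          2 / (3 * Real.log 2) * ((x.k : ℝ) * Real.log (x.n : ℝ)) ≤ (x.d : ℝ) ∧
          (x.d : ℝ) ≤ 2 / Real.log 2 * ((x.k : ℝ) * Real.log (x.n : ℝ))).Yes
          ⟨sumInstance x, sumInstance_dim x⟩) = decide (kClique.Yes x) :=
      decide_eq_decide.2 (sumInstance_yes_iff x)
    rw [hb] at hM'
    obtain ⟨h⟩ := precompose_outputs reduction Stk.inp Stk.out M hrun hM'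
    refine ⟨⟨h.toEvalsTo, h.steps_le_m.trans ?_⟩⟩
    change C * (x.encode.length + 1) ^ a + ((sumInstance x).encode.length + 1) +
      f (x.k * (x.k * 2)) * ((sumInstance x).encode.length + 1) ^ c ≤
      ((2 * C + 1) + f (x.k * (x.k * 2)) * (C + 1) ^ c) * (x.encode.length + 1) ^ (a + a * c)
    set n := x.encode.length + 1
    have hn : 1 ≤ n := Nat.le_add_left _ _
    have h1 : 1 ≤ n ^ a := Nat.one_le_pow _ _ hn
    have h2 : 1 ≤ n ^ (a * c) := Nat.one_le_pow _ _ hn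
    have h3 : (sumInstance x).encode.length + 1 ≤ (C + 1) * n ^ a := by nlinarith
    have h4 : ((sumInstance x).encode.length + 1) ^ c ≤ (C + 1) ^ c * n ^ (a * c) := by
      rw [pow_mul, ← mul_pow]
      exact Nat.pow_le_pow_left h3 c
    have h5 : n ^ a ≤ n ^ (a + a * c) := Nat.pow_le_pow_right hn (Nat.le_add_right _ _)
    have h6 : n ^ (a * c) ≤ n ^ (a + a * c) := Nat.pow_le_pow_right hn (Nat.le_add_left _ _)
    calc _ ≤ C * n ^ a + (C + 1) * n ^ a +
          f (x.k * (x.k * 2)) * ((C + 1) ^ c * n ^ (a * c)) := by gcongr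
      _ = (2 * C + 1) * n ^ a + f (x.k * (x.k * 2)) * (C + 1) ^ c * n ^ (a * c) := by ring
      _ ≤ (2 * C + 1) * n ^ (a + a * c) +
          f (x.k * (x.k * 2)) * (C + 1) ^ c * n ^ (a + a * c) := by gcongr
      _ = _ := by ring
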